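/- Let $G$ be a finite cyclic group of odd order, written additively. A sequence $S$ over $G$ is a finite unordered sequence of elements of $G$, repetition allowed; $|S|$ denotes its length and $\mathsf v_g(S)$ the multiplicity of $g \in G$ in $S$. The sequence $S$ is called zero-sum free if no nonempty subsequence of $S$ has sum $0$. If $S$ is a zero-sum free sequence over $G$ with $$|S| \ge \frac{6|G|+26}{20},$$ then $S$ contains an element $g \in G$ with multiplicity $$\mathsf v_g(S) \ge \frac{6|S|-|G|+1}{16}.$$ -/

import Mathlib

/-- The set `Σ(S)` of all sums `σ(T)` of subsequences `T` of `S` with `1 ≤ |T| ≤ |S|`.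
A (finite, unordered) sequence over `G` is a multiset, a subsequence is a sub-multiset. -/
def seqSubsums {G : Type*} [AddCommGroup G] (S : Multiset G) : Set G :=
  {g | ∃ T : Multiset G, T ≤ S ∧ 1 ≤ T.card ∧ T.sum = g}

/-- The sequence `S` is zero-sum free if `0 ∉ Σ(S)`. -/
def SeqZeroSumFree {G : Type*} [AddCommGroup G] (S : Multiset G) : Prop :=
  (0 : G) ∉ seqSubsums S

/-!
Let `h = (6|S| - |G|) / 16`, rounded down. If every multiplicity is at most `h`, then `S` decomposes
into `h` sets of at most six elements and a remainder of at most four. The sets `Σ₀` of all subset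
sums of disjoint pieces add up with `|Σ₀(S)| + 1 ≥ |Σ₀(S₁)| + |Σ₀(S₂)|`, because no nonzero element
of the first is the negative of an element of the second. A zero-sum free set of `3, 4, 5, 6`
elements has at least `7, 9, 15, 21` subset sums, so `|Σ₀(S)|` would exceed `|G|`.

The bounds for four to six elements come from counting differences. If `B = Σ₀(A)`, every `a ∈ A`
has at least `|Σ₀(A \ {a})|` representations as a difference of elements of `B`. The number of
missing representations is subadditive, and by Kneser's theorem the two- and three-fold sumsets of
`A ∪ {0} ∪ -A` are large, unless `A` lies in a small subgroup. Thus too small a `B` would have more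
than `|B| ^ 2` differences. In a small cyclic subgroup the bounds are verified by an exhaustive
search.
-/

open Finset AddAction
open scoped Pointwise

section Kneser

variable {G : Type*} [AddCommGroup G]

lemma card_dvd_ncard_of_le_stabilizer {H : AddSubgroup G} {s : Set G} (hs : H ≤ stabilizer G s) :
    Nat.card H ∣ s.ncard := by
  have hpre : ((↑) : G → G ⧸ H) ⁻¹' ((↑) '' s) = s := by
    rw [QuotientAddGroup.preimage_image_mk_eq_add, add_comm]
    exact subset_antisymm
      ((Set.add_subset_add_right hs).trans (stabilizer_add_self s).subset)
      fun x hx => ⟨0, H.zero_mem, x, hx, zero_add x⟩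
  rw [← Nat.card_coe_set_eq, ← hpre,
    Nat.card_congr (QuotientAddGroup.preimageMkEquivAddSubgroupProdSet _ _), Nat.card_prod]
  exact dvd_mul_right _ _

lemma exists_ncard_eq_mul {H L : AddSubgroup G} [Finite L] {X : Set G} (hHL : H ≤ L)
    (hX : H ≤ stabilizer G X) :
    ∃ t t', (L ∩ X : Set G).ncard = Nat.card H * t ∧ (L \ X : Set G).ncard = Nat.card H * t' ∧
      Nat.card L = Nat.card H * (t + t') := by
  have hL : H ≤ stabilizer G (L : Set G) := by rwa [stabilizer_addSubgroup]
  obtain ⟨t, ht⟩ := card_dvd_ncard_of_le_stabilizer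
    ((le_inf hL hX).trans stabilizer_inf_stabilizer_le_stabilizer_inter)
  obtain ⟨t', ht'⟩ := card_dvd_ncard_of_le_stabilizer
    ((le_inf hL hX).trans stabilizer_inf_stabilizer_le_stabilizer_sdiff)
  refine ⟨t, t', ht, ht', ?_⟩
  rw [mul_add, ← ht, ← ht', Set.ncard_inter_add_ncard_sdiff_eq_ncard _ _ (Set.toFinite _),
    ← Nat.card_coe_set_eq]
  rfl

lemma card_mul_card_le_card_inf_mul_card_add [DecidableEq G] {H K : AddSubgroup G} [Finite H]
    {P Q : Finset G} (hP : (P : Set G) ⊆ H) (hQ : (Q : Set G) ⊆ K) :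
    #P * #Q ≤ Nat.card (H ⊓ K : AddSubgroup G) * #(P + Q) := by
  rw [← card_product, ← image_add_product]
  refine card_le_mul_card_image _ _ fun u hu => ?_
  obtain ⟨⟨p, q⟩, hpq, rfl⟩ := mem_image.1 hu
  rw [mem_product] at hpq
  have hfin : ((H ⊓ K : AddSubgroup G) : Set G).Finite :=
    (Set.toFinite (H : Set G)).subset inf_le_left
  rw [← Set.ncard_coe_finset]
  refine Set.ncard_le_ncard_of_injOn (fun x => x.1 - p) ?_ ?_ hfin
  · rintro ⟨p', q'⟩ h
    simp only [coe_filter, Set.mem_ofPred_eq, mem_product] at h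
    have hsub : p' - p = q - q' := by
      rw [sub_eq_sub_iff_add_eq_add, h.2, add_comm]
    exact ⟨H.sub_mem (hP h.1.1) (hP hpq.1), hsub ▸ K.sub_mem (hQ hpq.2) (hQ h.1.2)⟩
  · rintro ⟨p₁, q₁⟩ h₁ ⟨p₂, q₂⟩ h₂ h
    simp only [coe_filter, Set.mem_ofPred_eq, sub_left_inj] at h₁ h₂ h
    subst h
    simpa using h₁.2.trans h₂.2.symm

lemma ncard_mul_ncard_le {H K : AddSubgroup G} [Finite H] [Finite K] {P Q : Set G} {B : Finset G}
    (hP : P ⊆ H) (hQ : Q ⊆ K) (hB : P + Q ⊆ B) :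
    P.ncard * Q.ncard ≤ Nat.card (H ⊓ K : AddSubgroup G) * #B := by
  classical
  lift P to Finset G using (Set.toFinite (H : Set G)).subset hP
  lift Q to Finset G using (Set.toFinite (K : Set G)).subset hQ
  rw [Set.ncard_coe_finset, Set.ncard_coe_finset]
  exact (card_mul_card_le_card_inf_mul_card_add hP hQ).trans
    (Nat.mul_le_mul_left _ (card_le_card (mod_cast hB)))

variable [DecidableEq G]

lemma exists_coset_counts {A B : Finset G} {H K : AddSubgroup G} [Finite H] [Finite K]
    (hA : H ≤ stabilizer G A) (hB : K ≤ stabilizer G B) (h0A : 0 ∉ A) (h0B : 0 ∈ B) :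
    ∃ p p' q q' : ℕ, 0 < p ∧ 0 < q' ∧
      Nat.card H = Nat.card (H ⊓ K : AddSubgroup G) * (p + p') ∧
      Nat.card K = Nat.card (H ⊓ K : AddSubgroup G) * (q + q') ∧
      Nat.card (H ⊓ K : AddSubgroup G) * (p * q') ≤ #(B \ A) ∧
      Nat.card (H ⊓ K : AddSubgroup G) * (p' * q) ≤ #(A \ B) := by
  have hkpos : 0 < Nat.card (H ⊓ K : AddSubgroup G) :=
    Nat.pos_of_dvd_of_pos (AddSubgroup.card_dvd_of_le inf_le_left) Nat.card_pos
  obtain ⟨p, p', hp, hp', hpp⟩ := exists_ncard_eq_mul (X := (B : Set G)) (inf_le_left : H ⊓ K ≤ H)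
    (by rw [stabilizer_coe_finset]; exact inf_le_right.trans hB)
  obtain ⟨q, q', hq, hq', hqq⟩ := exists_ncard_eq_mul (X := (A : Set G)) (inf_le_right : H ⊓ K ≤ K)
    (by rw [stabilizer_coe_finset]; exact inf_le_left.trans hA)
  have hmemA {h x} (hh : h ∈ H) : h + x ∈ A ↔ x ∈ A := mem_stabilizer_finset.1 (hA hh) x
  have hmemB {h x} (hh : h ∈ K) : x + h ∈ B ↔ x ∈ B := by
    rw [add_comm]; exact mem_stabilizer_finset.1 (hB hh) x
  have hle₁ := ncard_mul_ncard_le (P := H ∩ B) (Q := K \ A) (B := B \ A) Set.inter_subset_left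
    Set.sdiff_subset (by
      rintro _ ⟨x, ⟨hxH, hxB⟩, y, ⟨hyK, hyA⟩, rfl⟩
      exact mem_sdiff.2 ⟨(hmemB hyK).2 hxB, fun h => hyA ((hmemA hxH).1 h)⟩)
  have hle₂ := ncard_mul_ncard_le (P := H \ B) (Q := K ∩ A) (B := A \ B) Set.sdiff_subset
    Set.inter_subset_left (by
      rintro _ ⟨x, ⟨hxH, hxB⟩, y, ⟨hyK, hyA⟩, rfl⟩
      exact mem_sdiff.2 ⟨(hmemA hxH).2 hyA, fun h => hxB ((hmemB hyK).1 h)⟩)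
  rw [hp, hq', mul_mul_mul_comm, mul_assoc] at hle₁
  rw [hp', hq, mul_mul_mul_comm, mul_assoc] at hle₂
  refine ⟨p, p', q, q', ?_, ?_, hpp, hqq, Nat.le_of_mul_le_mul_left hle₁ hkpos,
    Nat.le_of_mul_le_mul_left hle₂ hkpos⟩
  · rw [← mul_pos_iff_of_pos_left hkpos, ← hp]
    exact (Set.ncard_pos ((Set.toFinite (H : Set G)).inter_of_left _)).2 ⟨0, H.zero_mem, h0B⟩
  · rw [← mul_pos_iff_of_pos_left hkpos, ← hq']
    exact (Set.ncard_pos ((Set.toFinite (K : Set G)).sdiff)).2 ⟨0, K.zero_mem, h0A⟩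

lemma coset_count_trichotomy {k p p' q q' s t : ℕ} (hp : 0 < p) (hq' : 0 < q')
    (hs : k * (p * q') ≤ s) (ht : k * (p' * q) ≤ t) :
    k * (p + p') ≤ s + k ∨ k * (q + q') ≤ t + k ∨ k * (q + q') ≤ s := by
  have hadd {a b : ℕ} (ha : 0 < a) (hb : 0 < b) : a + b ≤ a * b + 1 := by nlinarith
  rcases q.eq_zero_or_pos with rfl | hq
  · right; right; nlinarith
  rcases p'.eq_zero_or_pos with rfl | hp'
  · left; nlinarith
  have hor : p + p' ≤ p * q' + 1 ∨ q + q' ≤ p' * q + 1 := by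
    have := hadd hp hq'
    have := hadd hp' hq
    omega
  rcases hor with h | h
  · left; nlinarith
  · right; left; nlinarith

lemma card_le_of_mem_of_notMem {A B : Finset G} {H K : AddSubgroup G} [Finite H] [Finite K]
    (hA : H ≤ stabilizer G A) (hB : K ≤ stabilizer G B) {z : G} (hzA : z ∉ A) (hzB : z ∈ B) :
    Nat.card H ≤ #(B \ A) + Nat.card (H ⊓ K : AddSubgroup G) ∨
      Nat.card K ≤ #(A \ B) + Nat.card (H ⊓ K : AddSubgroup G) ∨ Nat.card K ≤ #(B \ A) := by
  obtain ⟨p, p', q, q', hp, hq', hH, hK, hs, ht⟩ := exists_coset_counts (H := H) (K := K)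
    (A := -z +ᵥ A) (B := -z +ᵥ B) (by rwa [stabilizer_vadd_eq_right])
    (by rwa [stabilizer_vadd_eq_right]) (by simpa [mem_neg_vadd_finset_iff])
    (by simpa [mem_neg_vadd_finset_iff])
  rw [← vadd_finset_sdiff, card_vadd_finset] at hs ht
  rw [hH, hK]
  exact coset_count_trichotomy hp hq' hs ht

/-- The stabilizer `{h | h + A = A}` of a finite set under translation, as a finite set. Its
elements are sought in `A - A`, so that the junk value for `A = ∅` is `∅`. -/
def addStab (A : Finset G) : Finset G := {h ∈ A - A | h +ᵥ A = A}

lemma mem_addStab {A : Finset G} (hA : A.Nonempty) {x : G} :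
    x ∈ addStab A ↔ x ∈ stabilizer G A := by
  obtain ⟨a, ha⟩ := hA
  refine ⟨fun h => (mem_filter.1 h).2, fun h => mem_filter.2 ⟨?_, h⟩⟩
  rw [← add_sub_cancel_right x a]
  exact sub_mem_sub (h ▸ vadd_mem_vadd_finset ha) ha

lemma coe_addStab {A : Finset G} (hA : A.Nonempty) : (addStab A : Set G) = stabilizer G A :=
  Set.ext fun _ => mem_addStab hA

lemma card_addStab {A : Finset G} (hA : A.Nonempty) :
    #(addStab A) = Nat.card (stabilizer G A) := by
  rw [← Set.ncard_coe_finset, coe_addStab hA, ← Nat.card_coe_set_eq]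
  rfl

lemma finite_stabilizer {A : Finset G} (hA : A.Nonempty) : Finite (stabilizer G A) :=
  (coe_addStab hA ▸ finite_toSet (addStab A) : (stabilizer G A : Set G).Finite)

lemma card_le_card_addStab {A : Finset G} (hA : A.Nonempty) {H : AddSubgroup G}
    (hH : H ≤ stabilizer G A) : Nat.card H ≤ #(addStab A) := by
  have := finite_stabilizer hA
  rw [card_addStab hA]
  exact Nat.card_mono (Set.toFinite _) hH

/-- Kneser's lemma on unions of periodic sets. -/
lemma le_card_union_add_card_addStab {A B : Finset G} (hA : A.Nonempty) (hB : B.Nonempty) {s : ℕ}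
    (hsA : s ≤ #A + #(addStab A)) (hsB : s ≤ #B + #(addStab B)) :
    s ≤ #(A ∪ B) + #(addStab (A ∪ B)) := by
  by_cases hBA : B ⊆ A
  · rwa [union_eq_left.2 hBA]
  by_cases hAB : A ⊆ B
  · rwa [union_eq_right.2 hAB]
  obtain ⟨z, hzB, hzA⟩ := not_subset.1 hBA
  obtain ⟨w, hwA, hwB⟩ := not_subset.1 hAB
  have := finite_stabilizer hA
  have := finite_stabilizer hB
  have hstab : Nat.card (stabilizer G A ⊓ stabilizer G B : AddSubgroup G) ≤ #(addStab (A ∪ B)) := by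
    refine card_le_card_addStab (hA.mono subset_union_left) ?_
    exact mod_cast stabilizer_inf_stabilizer_le_stabilizer_union (s := (A : Set G)) (t := B)
  have hz := card_le_of_mem_of_notMem le_rfl le_rfl hzA hzB
  have hw := card_le_of_mem_of_notMem le_rfl le_rfl hwB hwA
  rw [inf_comm] at hw
  rw [← card_addStab hA, ← card_addStab hB] at hz hw
  have hunion := card_sdiff_add_card A B
  have hunion' := card_sdiff_add_card B A
  rw [union_comm B A] at hunion'
  omega

/-- Iterated Dyson transforms replace `B` by a set whose translate by `-b` stabilizes `A`. -/
lemma exists_subset_add_le_card_add_card_addStab {A B : Finset G} {a b : G} (ha : a ∈ A)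
    (hb : b ∈ B) :
    ∃ C ⊆ A + B, a + b ∈ C ∧ #A + #B ≤ #C + #(addStab C) := by
  induction hn : #B using Nat.strong_induction_on generalizing A B with
  | _ n ih =>
  subst hn
  by_cases h : ∀ e ∈ A, (e - b) +ᵥ B ⊆ A
  · refine ⟨b +ᵥ A, ?_, ?_, ?_⟩
    · rw [add_comm]
      exact vadd_finset_subset_add hb
    · rw [add_comm]
      exact vadd_mem_vadd_finset ha
    · rw [card_vadd_finset, ← card_vadd_finset (-b) B]
      gcongr
      intro x hx
      rw [mem_neg_vadd_finset_iff, vadd_eq_add] at hx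
      rw [mem_addStab (Nonempty.vadd_finset ⟨a, ha⟩), stabilizer_vadd_eq_right]
      refine mem_stabilizer_finset_iff_vadd_finset_subset.2 fun y hy => ?_
      obtain ⟨e, he, rfl⟩ := mem_vadd_finset.1 hy
      exact h e he (mem_vadd_finset.2 ⟨b + x, hx, by simp only [vadd_eq_add]; abel⟩)
  · push Not at h
    obtain ⟨e, he, hBA⟩ := h
    set x := addDysonETransform (e - b) (A, B)
    have hlt : #x.2 < #B := by
      refine card_lt_card (ssubset_of_subset_not_subset inter_subset_left fun hsub => hBA ?_)
      rw [vadd_finset_subset_iff]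
      exact hsub.trans inter_subset_right
    obtain ⟨C, hC, hab, hle⟩ := ih _ hlt (A := x.1) (B := x.2) (mem_union_left _ ha)
      (mem_inter.2 ⟨hb, mem_neg_vadd_finset_iff.2 (by simpa)⟩) rfl
    exact ⟨C, hC.trans (addDysonETransform.subset _ _), hab,
      (addDysonETransform.card (e - b) (A, B)).symm.le.trans hle⟩

lemma card_add_card_le_card_add_card_addStab {A B : Finset G} (hA : A.Nonempty)
    (hB : B.Nonempty) : #A + #B ≤ #(A + B) + #(addStab (A + B)) := by
  obtain ⟨a, ha⟩ := hA
  obtain ⟨b, hb⟩ := hB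
  set 𝒟 := {D ∈ (A + B).powerset | D.Nonempty ∧ #A + #B ≤ #D + #(addStab D)} with h𝒟
  have h𝒟_nonempty : 𝒟.Nonempty := by
    obtain ⟨C, hC, hab, hle⟩ := exists_subset_add_le_card_add_card_addStab ha hb
    exact ⟨C, mem_filter.2 ⟨mem_powerset.2 hC, ⟨_, hab⟩, hle⟩⟩
  obtain ⟨D, hD, hmax⟩ := exists_max_image 𝒟 card h𝒟_nonempty
  obtain ⟨hDsub, hDne, hDle⟩ := by simpa [h𝒟] using hD
  suffices hsub : A + B ⊆ D by rwa [hDsub.antisymm hsub] at hDle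
  rintro _ hx
  obtain ⟨a', ha', b', hb', rfl⟩ := mem_add.1 hx
  obtain ⟨C, hC, hab, hle⟩ := exists_subset_add_le_card_add_card_addStab ha' hb'
  have hunion : C ∪ D ∈ 𝒟 := mem_filter.2 ⟨mem_powerset.2 (union_subset hC hDsub),
    hDne.mono subset_union_right,
    le_card_union_add_card_addStab ⟨_, hab⟩ hDne hle hDle⟩
  exact eq_of_subset_of_card_le subset_union_right (hmax _ hunion) ▸ mem_union_left _ hab

lemma add_addStab (A : Finset G) : A + addStab A = A := by
  obtain rfl | hA := A.eq_empty_or_nonempty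
  · simp
  rw [← coe_inj, coe_add, coe_addStab hA, add_comm, ← stabilizer_coe_finset, stabilizer_add_self]

/-- **Kneser's theorem**. -/
lemma kneser {A B : Finset G} (hA : A.Nonempty) (hB : B.Nonempty) :
    #(A + addStab (A + B)) + #(B + addStab (A + B)) ≤ #(A + B) + #(addStab (A + B)) := by
  have hH : (addStab (A + B)).Nonempty := ⟨0, (mem_addStab (hA.add hB)).2 (zero_mem _)⟩
  have h := card_add_card_le_card_add_card_addStab (hA.add hH) (hB.add hH)
  rwa [add_add_add_comm, ← add_assoc, add_addStab, add_addStab] at h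

lemma card_add_card_le_of_unique_zero {A B : Finset G} (hA : 0 ∈ A) (hB : 0 ∈ B)
    (h : ∀ a ∈ A, ∀ b ∈ B, a + b = 0 → b = 0) : #A + #B ≤ #(A + B) + 1 := by
  have hAB : (A + B).Nonempty := ⟨_, add_mem_add hA hB⟩
  set H := addStab (A + B)
  have hhull {X : Finset G} (hX : 0 ∈ X) : #X + #H ≤ #(X + H) + #(X ∩ H) := by
    rw [← card_union_add_card_inter]
    gcongr
    exact union_subset (subset_add_left _ ((mem_addStab hAB).2 (zero_mem _)))
      (subset_add_right _ hX)
  have hdisj : #(A ∩ H) + #(B ∩ H) ≤ #H + 1 := by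
    rw [← card_neg (B ∩ H), ← card_union_add_card_inter]
    gcongr
    · refine union_subset inter_subset_right fun x hx => ?_
      simpa [H, mem_addStab hAB] using (mem_inter.1 (mem_neg'.1 hx)).2
    · rw [card_le_one_iff_subset_singleton]
      refine ⟨0, fun x hx => ?_⟩
      simp only [mem_inter, mem_neg'] at hx
      simpa using h _ hx.1.1 _ hx.2.1 (add_neg_cancel x)
  have hAH := hhull hA
  have hBH := hhull hB
  have hkneser : #(A + H) + #(B + H) ≤ #(A + B) + #H := kneser ⟨0, hA⟩ ⟨0, hB⟩
  omega

end Kneser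

section Representations

variable {G : Type*} [AddCommGroup G] [DecidableEq G]

/-- The number of ways to write `x` as a difference of two elements of `B`, counted by the minuend:
`b ∈ B ∩ (x + B)` corresponds to `x = b - (b - x)`. -/
def diffRep (B : Finset G) (x : G) : ℕ := #(B ∩ (x +ᵥ B))

lemma diffRep_le (B : Finset G) (x : G) : diffRep B x ≤ #B := card_le_card inter_subset_left

lemma diffRep_zero (B : Finset G) : diffRep B 0 = #B := by simp [diffRep]

lemma diffRep_neg (B : Finset G) (x : G) : diffRep B (-x) = diffRep B x := by
  rw [diffRep, ← card_vadd_finset x, vadd_finset_inter, vadd_neg_vadd, inter_comm, diffRep]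

lemma diffRep_eq_card_filter (B : Finset G) (x : G) :
    diffRep B x = #{p ∈ B ×ˢ B | p.1 - p.2 = x} := by
  rw [card_sub_eq, ← card_inter_vadd, diffRep]

lemma diffRep_pos {B : Finset G} {x : G} : 0 < diffRep B x ↔ x ∈ B - B := by
  simp [diffRep_eq_card_filter, card_pos, Finset.Nonempty, mem_sub, and_assoc]

lemma diffRep_add_le (B : Finset G) (x y : G) :
    diffRep B x + diffRep B y ≤ #B + diffRep B (x + y) := by
  have hy : diffRep B y = #((x +ᵥ B) ∩ ((x + y) +ᵥ B)) := by
    rw [diffRep, ← card_vadd_finset x, vadd_finset_inter, add_vadd]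
  rw [hy, diffRep, diffRep, ← card_union_add_card_inter, ← card_vadd_finset x B]
  gcongr
  · exact union_subset inter_subset_right inter_subset_left
  · exact inter_subset_left
  · exact inter_subset_right

/-- The elements having more than `t` representations as a difference of elements of `B`. -/
def popular (B : Finset G) (t : ℕ) : Finset G := {x ∈ B - B | t < diffRep B x}

lemma mem_popular {B : Finset G} {t : ℕ} {x : G} : x ∈ popular B t ↔ t < diffRep B x := by
  rw [popular, mem_filter, and_iff_right_iff_imp]
  exact fun h => diffRep_pos.1 (t.zero_le.trans_lt h)

lemma sum_card_popular (B : Finset G) : ∑ t ∈ range #B, #(popular B t) = #B ^ 2 := by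
  have hrange (x : G) : #{t ∈ range #B | t < diffRep B x} = diffRep B x := by
    rw [← card_range (diffRep B x)]
    congr 1
    ext t
    simpa using fun h => h.trans_le (diffRep_le B x)
  calc ∑ t ∈ range #B, #(popular B t) = ∑ x ∈ B - B, #{t ∈ range #B | t < diffRep B x} :=
        sum_card_bipartiteAbove_eq_sum_card_bipartiteBelow fun t x => t < diffRep B x
    _ = ∑ x ∈ B - B, #{p ∈ B ×ˢ B | p.1 - p.2 = x} :=
        sum_congr rfl fun x _ => (hrange x).trans (diffRep_eq_card_filter B x)
    _ = #(B ×ˢ B) := (card_eq_sum_card_fiberwise fun p hp =>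
        sub_mem_sub (mem_product.1 hp).1 (mem_product.1 hp).2).symm
    _ = #B ^ 2 := by rw [card_product, sq]

end Representations

section SubsetSums

variable {G : Type*} [AddCommGroup G]

lemma subsetSum_insert [DecidableEq G] {S : Finset G} {x : G} (hx : x ∉ S) :
    (insert x S).subsetSum = S.subsetSum ∪ (x +ᵥ S.subsetSum) := by
  refine subset_antisymm (fun y hy => ?_) (union_subset (subsetSum_mono (subset_insert x S))
    (vadd_finset_subsetSum_subset_subsetSum_insert hx))
  obtain ⟨T, hT, rfl⟩ := mem_subsetSum_iff.1 hy
  by_cases hxT : x ∈ T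
  · refine mem_union_right _ (mem_vadd_finset.2 ⟨∑ b ∈ T.erase x, b, ?_, add_sum_erase T id hxT⟩)
    exact mem_subsetSum_iff.2 ⟨_, subset_insert_iff.1 hT, rfl⟩
  · exact mem_union_left _ (mem_subsetSum_iff.2
      ⟨T, (subset_insert_iff_of_notMem hxT).1 hT, rfl⟩)

lemma card_subsetSum_insert_add_diffRep [DecidableEq G] {S : Finset G} {x : G} (hx : x ∉ S) :
    #(insert x S).subsetSum + diffRep S.subsetSum x = 2 * #S.subsetSum := by
  rw [subsetSum_insert hx, diffRep, card_union_add_card_inter, card_vadd_finset, two_mul]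

lemma card_subsetSum_le_diffRep_insert [DecidableEq G] {S : Finset G} {x : G} (hx : x ∉ S) :
    #S.subsetSum ≤ diffRep (insert x S).subsetSum x := by
  rw [diffRep, ← card_vadd_finset x S.subsetSum]
  refine card_le_card (subset_inter (vadd_finset_subsetSum_subset_subsetSum_insert hx) ?_)
  exact vadd_finset_subset_vadd_finset (subsetSum_mono (subset_insert x S))

lemma subsetSum_subset_of_subset [DecidableEq G] {S : Finset G} {H : AddSubgroup G}
    (hS : (S : Set G) ⊆ H) : (S.subsetSum : Set G) ⊆ H := by
  intro y hy
  obtain ⟨T, hT, rfl⟩ := mem_subsetSum_iff.1 hy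
  exact sum_mem fun x hx => hS (hT hx)

/-- A finite set none of whose nonempty subsets has sum zero. -/
def ZeroSumFree (S : Finset G) : Prop := ∀ T ⊆ S, T.Nonempty → ∑ x ∈ T, x ≠ 0

lemma ZeroSumFree.mono {S T : Finset G} (hS : ZeroSumFree S) (h : T ⊆ S) : ZeroSumFree T :=
  fun U hU => hS U (hU.trans h)

lemma ZeroSumFree.ne_zero {S : Finset G} (hS : ZeroSumFree S) {x : G} (hx : x ∈ S) : x ≠ 0 := by
  simpa using hS {x} (singleton_subset_iff.2 hx) (singleton_nonempty x)

end SubsetSums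

section SymmetricSets

variable {G : Type*} [AddCommGroup G]

lemma eq_zero_of_add_self_eq_zero (hodd : Odd (Nat.card G)) {x : G} (h : x + x = 0) : x = 0 := by
  rw [← AddMonoid.addOrderOf_eq_one_iff]
  exact Nat.eq_one_of_dvd_coprimes (Nat.coprime_two_right.2 hodd) (addOrderOf_dvd_natCard x)
    (addOrderOf_dvd_of_nsmul_eq_zero (by rw [two_nsmul, h]))

lemma ZeroSumFree.neg_notMem (hodd : Odd (Nat.card G)) {S : Finset G} (hS : ZeroSumFree S) {x : G}
    (hx : x ∈ S) : -x ∉ S := by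
  classical
  intro hneg
  have hne : x ≠ -x := fun h =>
    hS.ne_zero hx (eq_zero_of_add_self_eq_zero hodd (eq_neg_iff_add_eq_zero.1 h))
  refine hS {x, -x} (insert_subset hx (singleton_subset_iff.2 hneg)) (insert_nonempty _ _) ?_
  rw [sum_pair hne, add_neg_cancel]

variable [DecidableEq G]

lemma odd_card_of_neg_eq (hodd : Odd (Nat.card G)) {X : Finset G} (h0 : 0 ∈ X) (hX : -X = X) :
    Odd #X := by
  have heven : Even #(X.erase 0) := by
    rw [← ZMod.natCast_eq_zero_iff_even, card_eq_sum_ones, Nat.cast_sum]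
    refine sum_involution (fun x _ => -x) (fun x _ => by decide) (fun x hx _ h => ?_)
      (fun x hx => ?_) (fun x _ => neg_neg x)
    · refine (mem_erase.1 hx).1 (eq_zero_of_add_self_eq_zero hodd ?_)
      rwa [← neg_eq_iff_add_eq_zero]
    · rw [mem_erase] at hx ⊢
      exact ⟨neg_ne_zero.2 hx.1, hX ▸ neg_mem_neg hx.2⟩
  rw [← card_erase_add_one h0]
  exact heven.add_one

lemma neg_addStab (A : Finset G) : -addStab A = addStab A := by
  obtain rfl | hA := A.eq_empty_or_nonempty
  · simp [addStab]
  · ext x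
    simp [mem_addStab hA, mem_neg']

lemma card_addStab_dvd_card_add (C X : Finset G) : #(addStab X) ∣ #(C + addStab X) := by
  obtain rfl | hX := X.eq_empty_or_nonempty
  · simp [addStab]
  rw [card_addStab hX, ← Set.ncard_coe_finset]
  refine card_dvd_ncard_of_le_stabilizer fun h hh => ?_
  rw [mem_stabilizer_iff, coe_add, coe_addStab hX, ← add_vadd_comm]
  rw [← stabilizer_addSubgroup (stabilizer G X)] at hh
  rw [mem_stabilizer_iff.1 hh]

/-- The cosets of a subgroup of odd order that meet a symmetric set containing `0` are permuted by
negation, and only the subgroup itself is fixed. -/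
lemma subset_addStab_or_card_add_eq_mul (hodd : Odd (Nat.card G)) {C X : Finset G} (h0 : 0 ∈ C)
    (hC : -C = C) (hX : X.Nonempty) :
    C ⊆ addStab X ∨ ∃ m, Odd m ∧ 3 ≤ m ∧ #(C + addStab X) = m * #(addStab X) := by
  have h0X : 0 ∈ addStab X := (mem_addStab hX).2 (zero_mem _)
  obtain ⟨m, hm⟩ := card_addStab_dvd_card_add C X
  have hoddm : Odd m := by
    have := odd_card_of_neg_eq hodd (mem_add.2 ⟨0, h0, 0, h0X, add_zero 0⟩)
      (by rw [neg_add, hC, neg_addStab] : -(C + addStab X) = C + addStab X)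
    rw [hm, Nat.odd_mul] at this
    exact this.2
  obtain hm1 | hm1 := eq_or_ne m 1
  · left
    rw [eq_of_subset_of_card_le (subset_add_right _ h0) (hm.trans (by rw [hm1, mul_one])).le]
    exact subset_add_left _ h0X
  · exact Or.inr ⟨m, hoddm, by obtain ⟨k, rfl⟩ := hoddm; omega, hm.trans (mul_comm _ _)⟩

lemma odd_card_addStab (hodd : Odd (Nat.card G)) {X : Finset G} (hX : X.Nonempty) :
    Odd #(addStab X) := by
  rw [card_addStab hX]
  exact hodd.of_dvd_nat (AddSubgroup.card_addSubgroup_dvd_card _)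

/-- Kneser's theorem for `D + C`, according to whether the stabilizer has order `1`, `3` or at least
`5`. -/
lemma le_card_add_of_neg_eq (hodd : Odd (Nat.card G)) {C D : Finset G} (h0 : 0 ∈ C) (hC : -C = C)
    (hCD : C ⊆ D) {n : ℕ} (hn : n ≤ Nat.card (AddSubgroup.closure (C : Set G)))
    (h1 : n + 1 ≤ #D + #C) (h3 : n + 3 ≤ #D + #C ∨ ¬ 3 ∣ #C) (h5 : n ≤ max #D 15 + 10) :
    n ≤ #(D + C) := by
  have hX : (D + C).Nonempty := ⟨_, add_mem_add (hCD h0) h0⟩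
  have hkneser := kneser ⟨0, hCD h0⟩ ⟨0, h0⟩
  set H := addStab (D + C) with hH
  have h0H : 0 ∈ H := (mem_addStab hX).2 (zero_mem _)
  have hDH : #D ≤ #(D + H) := card_le_card (subset_add_left _ h0H)
  have hCH : #C ≤ #(C + H) := card_le_card (subset_add_left _ h0H)
  have hCDH : #(C + H) ≤ #(D + H) := card_le_card (add_subset_add_right hCD)
  obtain hsub | ⟨m, ⟨j, rfl⟩, hm3, hm⟩ := subset_addStab_or_card_add_eq_mul hodd h0 hC hX
  · have hclosure : AddSubgroup.closure (C : Set G) ≤ stabilizer G (D + C) :=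
      (AddSubgroup.closure_le _).2 fun x hx => (mem_addStab hX).1 (hsub hx)
    have hdvd : #H ∣ #(D + C) := by
      simpa only [add_addStab] using card_addStab_dvd_card_add (D + C) (D + C)
    exact (hn.trans (card_le_card_addStab hX hclosure)).trans (Nat.le_of_dvd (card_pos.2 hX) hdvd)
  obtain ⟨i, hi⟩ := odd_card_of_neg_eq hodd h0 hC
  obtain ⟨k, hk⟩ : Odd #H := odd_card_addStab hodd hX
  rw [← hH] at hm
  obtain hH1 | hH3 | hH5 : #H = 1 ∨ #H = 3 ∨ 5 ≤ #H := by omega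
  · omega
  · rw [hH3] at hm
    obtain rfl | hj : j = 1 ∨ 2 ≤ j := by omega
    · obtain rfl | hi4 : i = 4 ∨ i ≤ 3 := by omega
      · omega
      · omega
    · omega
  · have : 3 * #H ≤ #(C + H) := hm ▸ Nat.mul_le_mul_right _ hm3
    omega

/-- `S` together with `0` and the negatives of its elements. -/
def symHull (S : Finset G) : Finset G := insert 0 (S ∪ -S)

lemma mem_symHull {S : Finset G} {x : G} : x ∈ symHull S ↔ x = 0 ∨ x ∈ S ∨ -x ∈ S := by
  simp [symHull]

lemma zero_mem_symHull (S : Finset G) : 0 ∈ symHull S := mem_insert_self _ _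

lemma subset_symHull (S : Finset G) : S ⊆ symHull S := fun _ hx => mem_symHull.2 (.inr (.inl hx))

lemma neg_symHull (S : Finset G) : -symHull S = symHull S := by
  ext x
  simp [mem_neg', mem_symHull, or_comm]

lemma card_symHull (hodd : Odd (Nat.card G)) {S : Finset G} (hS : ZeroSumFree S) :
    #(symHull S) = 2 * #S + 1 := by
  rw [symHull, card_insert_of_notMem, card_union_of_disjoint, card_neg, two_mul]
  · exact disjoint_left.2 fun x hx hneg => hS.neg_notMem hodd hx (mem_neg'.1 hneg)
  · simpa using fun h => hS.ne_zero h rfl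

lemma card_closure_le_card_closure_symHull (hodd : Odd (Nat.card G)) (S : Finset G) :
    Nat.card (AddSubgroup.closure (S : Set G)) ≤
      Nat.card (AddSubgroup.closure (symHull S : Set G)) :=
  have : Finite G := Nat.finite_of_card_ne_zero hodd.pos.ne'
  AddSubgroup.card_le_of_le (AddSubgroup.closure_mono (mod_cast subset_symHull S))

lemma le_card_symHull_add_symHull (hodd : Odd (Nat.card G)) {S : Finset G} (hS : ZeroSumFree S)
    {n : ℕ} (hn : n ≤ Nat.card (AddSubgroup.closure (S : Set G)))
    (h : #S = 4 ∧ n ≤ 15 ∨ #S = 5 ∧ n ≤ 21 ∨ #S = 6 ∧ n ≤ 25) :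
    n ≤ #(symHull S + symHull S) := by
  have hcard := card_symHull hodd hS
  exact le_card_add_of_neg_eq hodd (zero_mem_symHull S) (neg_symHull S) subset_rfl
    (hn.trans (card_closure_le_card_closure_symHull hodd S)) (by omega) (by omega) (by omega)

lemma le_card_symHull_add_symHull_add_symHull (hodd : Odd (Nat.card G)) {S : Finset G}
    (hS : ZeroSumFree S) {n : ℕ} (hn : n ≤ Nat.card (AddSubgroup.closure (S : Set G)))
    (h : #S = 4 ∧ n ≤ 21 ∨ #S = 5 ∧ n ≤ 31 ∨ #S = 6 ∧ n ≤ 31) :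
    n ≤ #(symHull S + symHull S + symHull S) := by
  have hcard := card_symHull hodd hS
  have hdouble := le_card_symHull_add_symHull hodd hS
    (n := min n (if #S = 4 then 15 else if #S = 5 then 21 else 25)) ((min_le_left _ _).trans hn)
    (by split_ifs <;> omega)
  have hadd : #(symHull S + symHull S) ≤ #(symHull S + symHull S + symHull S) :=
    card_le_card (subset_add_left _ (zero_mem_symHull S))
  rcases le_or_gt n #(symHull S + symHull S) with hle | hlt
  · exact hle.trans hadd
  · exact le_card_add_of_neg_eq hodd (zero_mem_symHull S) (neg_symHull S)
      (subset_add_left _ (zero_mem_symHull S))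
      (hn.trans (card_closure_le_card_closure_symHull hodd S))
      (by split_ifs at hdouble <;> omega) (by split_ifs at hdouble <;> omega)
      (by split_ifs at hdouble <;> omega)

end SymmetricSets

section Search

section SumRep

variable {G : Type*} [AddCommGroup G] [DecidableEq G]

/-- The number of subsets of `S` with sum `t`. -/
def sumRep (S : Finset G) (t : G) : ℕ := #{T ∈ S.powerset | ∑ x ∈ T, x = t}

lemma sumRep_insert {S : Finset G} {x : G} (hx : x ∉ S) (t : G) :
    sumRep (insert x S) t = sumRep S t + sumRep S (t - x) := by
  simp only [sumRep, card_filter]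
  rw [sum_powerset_insert hx]
  congr 1
  refine sum_congr rfl fun T hT => if_congr ?_ rfl rfl
  rw [sum_insert fun h => hx (mem_powerset.1 hT h), eq_sub_iff_add_eq']

lemma sumRep_empty (t : G) : sumRep ∅ t = if t = 0 then 1 else 0 := by
  obtain rfl | ht := eq_or_ne t 0
  · simp [sumRep, filter_singleton]
  · simp [sumRep, filter_singleton, ht, ht.symm]

lemma sumRep_pos {S : Finset G} {t : G} : 0 < sumRep S t ↔ t ∈ S.subsetSum := by
  simp [sumRep, card_pos, Finset.Nonempty, mem_subsetSum_iff]

lemma ZeroSumFree.sumRep_zero {S : Finset G} (hS : ZeroSumFree S) : sumRep S 0 = 1 := by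
  rw [sumRep, card_eq_one]
  refine ⟨∅, eq_singleton_iff_unique_mem.2 ⟨by simp, fun T hT => ?_⟩⟩
  rw [mem_filter, mem_powerset] at hT
  exact not_nonempty_iff_eq_empty.1 fun hne => hS T hT.1 hne hT.2

end SumRep

/-- The number of ones among the lowest `n` binary digits of `M`. -/
def bitCount (M : ℕ) : ℕ → ℕ
  | 0 => 0
  | n + 1 => (M >>> n) % 2 + bitCount M n

/-- The cyclic rotation by `x` places of an `N`-digit binary number. -/
def rotateBits (N M x : ℕ) : ℕ := ((M <<< x) ||| (M >>> (N - x))) % 2 ^ N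

/-- A search through the `k`-element sets of absolute residues in `{1, …, x}` modulo `N`, adjoined
to a set of larger ones. The digits of `M` and `M'` mark the residues which, up to a common
translation, are obtained at least once and at least twice as sums of chosen elements. The search
fails when it meets fewer than `b` sums, one of which is obtained only once. -/
def sumSearch (N b : ℕ) : ℕ → ℕ → ℕ → ℕ → Bool
  | _, 0, M, M' => M == M' || b.ble (bitCount M N)
  | 0, _ + 1, _, _ => true
  | x + 1, k + 1, M, M' =>
    sumSearch N b x k (M ||| rotateBits N M (x + 1))
        (M' ||| rotateBits N M' (x + 1) ||| (M &&& rotateBits N M (x + 1))) &&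
      sumSearch N b x (k + 1) M M'

/-- The binary digits of `M` code the subset `A` of `ZMod N`. -/
def Codes (N M : ℕ) (A : Set (ZMod N)) : Prop :=
  ∀ i, M.testBit i = true ↔ i < N ∧ (i : ZMod N) ∈ A

lemma bitCount_eq_card (M n : ℕ) : bitCount M n = #{i ∈ range n | M.testBit i} := by
  induction n with
  | zero => rfl
  | succ n ih =>
    rw [bitCount, ih, Nat.shiftRight_eq_div_pow, ← Nat.toNat_testBit, range_add_one, filter_insert]
    cases M.testBit n
    · simp
    · simp [add_comm]

namespace Codes

variable {N M M' : ℕ} {A B : Set (ZMod N)}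

lemma or (h : Codes N M A) (h' : Codes N M' B) : Codes N (M ||| M') (A ∪ B) := fun i => by
  rw [Nat.testBit_or, Bool.or_eq_true, h i, h' i, Set.mem_union, and_or_left]

lemma and (h : Codes N M A) (h' : Codes N M' B) : Codes N (M &&& M') (A ∩ B) := fun i => by
  rw [Nat.testBit_and, Bool.and_eq_true, h i, h' i, Set.mem_inter_iff, and_and_and_comm, and_self]

lemma rotateBits (h : Codes N M A) {x : ℕ} (hx : x < N) :
    Codes N (rotateBits N M x) {t | t - x ∈ A} := fun i => by
  simp only [_root_.rotateBits, Nat.testBit_mod_two_pow, Nat.testBit_or, Nat.testBit_shiftLeft,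
    Nat.testBit_shiftRight, Bool.and_eq_true, Bool.or_eq_true, decide_eq_true_eq, h _,
    Set.mem_ofPred_eq]
  refine and_congr_right fun hi => ?_
  rcases le_or_gt x i with hxi | hxi
  · rw [← Nat.cast_sub hxi, or_iff_left (by omega), and_iff_right hxi, and_iff_right (by omega)]
  · rw [or_iff_right (by omega), and_iff_right (by omega), Nat.cast_add, Nat.cast_sub hx.le,
      ZMod.natCast_self, zero_sub, neg_add_eq_sub]

variable [NeZero N]

lemma bitCount {A : Finset (ZMod N)} (h : Codes N M A) : bitCount M N = #A := by
  rw [bitCount_eq_card]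
  refine card_nbij' (fun i => (i : ZMod N)) ZMod.val ?_ ?_ ?_ ?_
  · exact fun i hi => ((h i).1 (mem_filter.1 hi).2).2
  · refine fun a ha => mem_filter.2 ⟨mem_range.2 (ZMod.val_lt a), (h _).2 ⟨ZMod.val_lt a, ?_⟩⟩
    rwa [ZMod.natCast_zmod_val]
  · exact fun i hi => ZMod.val_natCast_of_lt (mem_range.1 (mem_filter.1 hi).1)
  · exact fun a _ => ZMod.natCast_zmod_val a

lemma eq (h : Codes N M A) (h' : Codes N M B) : A = B := by
  ext a
  have := (h a.val).symm.trans (h' a.val)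
  rwa [ZMod.natCast_zmod_val, and_congr_right_iff, imp_iff_right (ZMod.val_lt a)] at this

end Codes

lemma codes_one (N : ℕ) [NeZero N] : Codes N 1 {0} := fun i => by
  rw [Nat.testBit_one_eq_true_iff_self_eq_zero, Set.mem_singleton_iff, ZMod.natCast_eq_zero_iff]
  exact ⟨by rintro rfl; exact ⟨NeZero.pos N, dvd_zero N⟩,
    fun h => Nat.eq_zero_of_dvd_of_lt h.2 h.1⟩

lemma codes_zero (N : ℕ) : Codes N 0 ∅ := fun i => by simp

/-- `M` and `M'` code the residues which occur at least once and at least twice as a sum of elements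
of `P`, up to a common translation. -/
def CodesSums (N M M' : ℕ) (P : Finset (ZMod N)) : Prop :=
  ∃ c, Codes N M {t | 0 < sumRep P (t - c)} ∧ Codes N M' {t | 1 < sumRep P (t - c)}

lemma codesSums_empty (N : ℕ) [NeZero N] : CodesSums N 1 0 ∅ := by
  refine ⟨0, ?_, ?_⟩
  · convert codes_one N using 1
    ext t
    by_cases ht : t = 0 <;> simp [sumRep_empty, ht]
  · convert codes_zero N using 1
    ext t
    by_cases ht : t = 0 <;> simp [sumRep_empty, ht]

/-- Adjoining `-x` instead of `x` only translates the subset sums. -/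
lemma codesSums_insert {N M M' x : ℕ} {P : Finset (ZMod N)} (h : CodesSums N M M' P) (hx : x < N)
    {y : ZMod N} (hy : y ∉ P) (hyx : y = x ∨ y = -x) :
    CodesSums N (M ||| rotateBits N M x)
      (M' ||| rotateBits N M' x ||| (M &&& rotateBits N M x)) (insert y P) := by
  obtain ⟨c, h₁, h₂⟩ := h
  obtain ⟨d, hd⟩ : ∃ d, ∀ t, sumRep (insert y P) (t - d) =
      sumRep P (t - c) + sumRep P (t - x - c) := by
    obtain rfl | rfl := hyx
    · exact ⟨c, fun t => by rw [sumRep_insert hy, sub_right_comm t c]⟩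
    · exact ⟨x + c, fun t => by rw [sumRep_insert hy, add_comm, ← sub_sub, sub_neg_eq_add,
        sub_right_comm t, sub_add_cancel]⟩
  refine ⟨d, ?_, ?_⟩
  · convert h₁.or (h₁.rotateBits hx) using 1
    ext t
    simp only [hd, Set.mem_union, Set.mem_ofPred_eq]
    omega
  · convert (h₂.or (h₂.rotateBits hx)).or (h₁.and (h₁.rotateBits hx)) using 1
    ext t
    simp only [hd, Set.mem_union, Set.mem_inter_iff, Set.mem_ofPred_eq]
    omega

lemma CodesSums.bitCount_eq {N M M' : ℕ} [NeZero N] {P : Finset (ZMod N)}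
    (h : CodesSums N M M' P) : bitCount M N = #P.subsetSum := by
  obtain ⟨c, h₁, -⟩ := h
  rw [← card_vadd_finset c P.subsetSum]
  refine Codes.bitCount ?_
  convert h₁ using 1
  ext t
  rw [mem_coe, ← neg_vadd_mem_iff, Set.mem_ofPred_eq, sumRep_pos, vadd_eq_add, neg_add_eq_sub]

lemma CodesSums.ne {N M M' : ℕ} [NeZero N] {P : Finset (ZMod N)} (h : CodesSums N M M' P)
    (hP : ZeroSumFree P) : M ≠ M' := by
  rintro rfl
  obtain ⟨c, h₁, h₂⟩ := h
  have hc := Set.ext_iff.1 (h₁.eq h₂) c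
  simp [hP.sumRep_zero] at hc

/-- The elements of `S` whose absolutely least residue exceeds `x` in absolute value. -/
def farPart {N : ℕ} (S : Finset (ZMod N)) (x : ℕ) : Finset (ZMod N) :=
  {s ∈ S | x < s.valMinAbs.natAbs}

lemma ZeroSumFree.farPart_succ {N : ℕ} (hodd : Odd N) {S : Finset (ZMod N)} (hS : ZeroSumFree S)
    (x : ℕ) : farPart S x = farPart S (x + 1) ∨ ∃ y ∉ farPart S (x + 1),
      (y = (x + 1 : ℕ) ∨ y = -(x + 1 : ℕ)) ∧ farPart S x = insert y (farPart S (x + 1)) := by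
  by_cases h : ∃ y ∈ S, y.valMinAbs.natAbs = x + 1
  · obtain ⟨y, hyS, hy⟩ := h
    have hunique : ∀ s ∈ S, s.valMinAbs.natAbs = x + 1 → s = y := fun s hs hsx => by
      refine (ZMod.natAbs_valMinAbs_eq_natAbs_valMinAbs.1 (hsx.trans hy.symm)).resolve_right ?_
      rintro rfl
      exact hS.neg_notMem (by rwa [Nat.card_zmod]) hyS hs
    refine Or.inr ⟨y, by simp [farPart, hy], ?_, ?_⟩
    · rw [← hy]
      refine (Int.natAbs_eq y.valMinAbs).imp (fun h => ?_) fun h => ?_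
      · rw [← Int.cast_natCast, ← h, ZMod.coe_valMinAbs]
      · rw [← Int.cast_natCast, ← Int.cast_neg, ← h, ZMod.coe_valMinAbs]
    · ext s
      simp only [farPart, mem_insert, mem_filter]
      grind
  · push Not at h
    refine Or.inl (filter_congr fun s hs => ?_)
    have := h s hs
    omega

lemma ZeroSumFree.le_card_of_sumSearch_of_codesSums {N b : ℕ} [NeZero N] (hodd : Odd N)
    {S : Finset (ZMod N)} (hS : ZeroSumFree S) {x k M M' : ℕ}
    (hsearch : sumSearch N b x k M M' = true) (hx : x < N) (hk : k + #(farPart S x) = #S)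
    (hM : CodesSums N M M' (farPart S x)) : b ≤ #S.subsetSum := by
  fun_induction sumSearch N b x k M M' with
  | case1 x M M' =>
    have hfar : farPart S x = S :=
      eq_of_subset_of_card_le (filter_subset _ _) (by rw [← hk, zero_add])
    rw [hfar] at hM
    rwa [Bool.or_eq_true, beq_iff_eq, or_iff_right (hM.ne hS), Nat.ble_eq, hM.bitCount_eq]
      at hsearch
  | case2 k M M' =>
    have hfar : farPart S 0 = S := filter_true_of_mem fun s hs =>
      Int.natAbs_pos.2 ((ZMod.valMinAbs_eq_zero s).not.2 (hS.ne_zero hs))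
    rw [hfar] at hk
    omega
  | case3 x k M M' ih_adjoin ih_skip =>
    rw [Bool.and_eq_true] at hsearch
    simp only [Nat.succ_eq_add_one] at hk hM hx
    obtain heq | ⟨y, hy, hyx, heq⟩ := hS.farPart_succ hodd x
    · exact ih_skip hsearch.2 (by omega) (heq ▸ hk) (heq ▸ hM)
    · refine ih_adjoin hsearch.1 (by omega) ?_ (heq ▸ codesSums_insert hM hx hy hyx)
      rw [heq, card_insert_of_notMem hy]
      omega

lemma ZeroSumFree.le_card_of_sumSearch_zmod {N b : ℕ} [NeZero N] (hodd : Odd N)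
    {S : Finset (ZMod N)} (hS : ZeroSumFree S) (h : sumSearch N b (N / 2) #S 1 0 = true) :
    b ≤ #S.subsetSum := by
  have hfar : farPart S (N / 2) = ∅ :=
    filter_false_of_mem fun s _ => (ZMod.natAbs_valMinAbs_le s).not_gt
  refine hS.le_card_of_sumSearch_of_codesSums hodd h (by have := hodd.pos; omega) ?_ ?_
  · rw [hfar, card_empty, add_zero]
  · rw [hfar]
    exact codesSums_empty N

lemma subsetSum_image {G H : Type*} [AddCommGroup G] [AddCommGroup H] [DecidableEq G]
    [DecidableEq H] (f : G →+ H) (hf : Function.Injective f) (S : Finset G) :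
    (S.image f).subsetSum = S.subsetSum.image f := by
  rw [subsetSum, subsetSum, powerset_image, image_image, image_image]
  refine image_congr fun T _ => ?_
  rw [Function.comp_apply, Function.comp_apply, sum_image hf.injOn, map_sum]
  rfl

lemma ZeroSumFree.exists_zmod {G : Type*} [AddCommGroup G] [IsAddCyclic G] [DecidableEq G]
    {S : Finset G} (hS : ZeroSumFree S) :
    ∃ R : Finset (ZMod (Nat.card (AddSubgroup.closure (S : Set G)))),
      ZeroSumFree R ∧ #R = #S ∧ #R.subsetSum = #S.subsetSum := by
  set K := AddSubgroup.closure (S : Set G)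
  set e := zmodAddCyclicAddEquiv (inferInstance : IsAddCyclic K)
  set f : ZMod (Nat.card K) →+ G := K.subtype.comp e.toAddMonoidHom
  have hf : Function.Injective f := K.subtype_injective.comp e.injective
  obtain ⟨R, -, hR⟩ := subset_set_image_iff.1 (show (S : Set G) ⊆ f '' Set.univ from
    fun x hx => ⟨e.symm ⟨x, AddSubgroup.subset_closure hx⟩, trivial, by simp [f]⟩)
  refine ⟨R, fun T hT hTne hsum => ?_, ?_, ?_⟩
  · refine hS (T.image f) (hR ▸ image_subset_image hT) (hTne.image f) ?_
    rw [sum_image hf.injOn, ← map_sum, hsum, map_zero]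
  · rw [← hR, card_image_of_injective _ hf]
  · rw [← hR, subsetSum_image f hf, card_image_of_injective _ hf]

section SmallClosure

variable {G : Type*} [AddCommGroup G] [IsAddCyclic G] [DecidableEq G] {S : Finset G}

lemma ZeroSumFree.le_card_of_sumSearch (hodd : Odd (Nat.card G)) (hS : ZeroSumFree S) {n : ℕ}
    (hn : Nat.card (AddSubgroup.closure (S : Set G)) < n) {b : ℕ → ℕ}
    (h : ∀ N < n, Odd N → sumSearch N (b N) (N / 2) #S 1 0 = true) :
    b (Nat.card (AddSubgroup.closure (S : Set G))) ≤ #S.subsetSum := by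
  have hN : Odd (Nat.card (AddSubgroup.closure (S : Set G))) :=
    hodd.of_dvd_nat (AddSubgroup.card_addSubgroup_dvd_card _)
  have : NeZero (Nat.card (AddSubgroup.closure (S : Set G))) := ⟨hN.pos.ne'⟩
  obtain ⟨R, hR, hcard, hsum⟩ := hS.exists_zmod
  rw [← hsum]
  exact hR.le_card_of_sumSearch_zmod hN (hcard ▸ h _ hn hN)

set_option maxRecDepth 100000 in
lemma ZeroSumFree.card_four_of_small (hodd : Odd (Nat.card G)) (hS : ZeroSumFree S)
    (h4 : #S = 4) (hN : Nat.card (AddSubgroup.closure (S : Set G)) < 15) :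
    10 ≤ #S.subsetSum ∨
      9 ≤ #S.subsetSum ∧ Nat.card (AddSubgroup.closure (S : Set G)) = 9 := by
  have := hS.le_card_of_sumSearch hodd hN (b := fun N => if N = 9 then 9 else 10)
    (by rw [h4]; decide +kernel)
  grind

set_option maxRecDepth 100000 in
lemma ZeroSumFree.card_five_of_small (hodd : Odd (Nat.card G)) (hS : ZeroSumFree S)
    (h5 : #S = 5) (hN : Nat.card (AddSubgroup.closure (S : Set G)) < 21) :
    15 ≤ #S.subsetSum :=
  hS.le_card_of_sumSearch hodd hN (b := fun _ => 15) (by rw [h5]; decide +kernel)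

set_option maxRecDepth 100000 in
lemma ZeroSumFree.card_six_of_small (hodd : Odd (Nat.card G)) (hS : ZeroSumFree S)
    (h6 : #S = 6) (hN : Nat.card (AddSubgroup.closure (S : Set G)) < 31) :
    21 ≤ #S.subsetSum :=
  hS.le_card_of_sumSearch hodd hN (b := fun _ => 21) (by rw [h6]; decide +kernel)

end SmallClosure

end Search

section FewElements

variable {G : Type*} [AddCommGroup G] [DecidableEq G] {S : Finset G}

lemma mem_subsetSum_pair {a b t : G} (h : a ≠ b) :
    t ∈ ({a, b} : Finset G).subsetSum ↔ t = 0 ∨ t = a ∨ t = b ∨ t = a + b := by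
  have hb : ({b} : Finset G).subsetSum = {0, b} := by
    rw [← insert_empty_eq, subsetSum_insert (notMem_empty b)]
    simp [subsetSum]
  rw [subsetSum_insert (by simpa using h), hb, mem_union, ← neg_vadd_mem_iff, vadd_eq_add,
    neg_add_eq_sub]
  simp only [mem_insert, mem_singleton, sub_eq_iff_eq_add', add_zero]
  tauto

lemma ZeroSumFree.card_two (hS : ZeroSumFree S) (h2 : #S = 2) : 4 ≤ #S.subsetSum := by
  obtain ⟨a, b, hab, rfl⟩ := card_eq_two.1 h2
  have ha : a ≠ 0 := hS.ne_zero (by simp)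
  have hb : b ≠ 0 := hS.ne_zero (by simp)
  have hsum : a + b ≠ 0 := sum_pair (f := id) hab ▸ hS {a, b} subset_rfl (by simp)
  have h4 : #({0, a, b, a + b} : Finset G) = 4 := by
    rw [card_insert_of_notMem, card_insert_of_notMem, card_pair] <;> simp <;> grind
  rw [← h4]
  exact card_le_card fun t ht => (mem_subsetSum_pair hab).2 (by simpa using ht)

lemma ZeroSumFree.add_ne_zero {a b c : G} (hS : ZeroSumFree {a, b, c}) (hab : a ≠ b) (hac : a ≠ c)
    (hbc : b ≠ c) :
    a ≠ 0 ∧ b ≠ 0 ∧ c ≠ 0 ∧ a + b ≠ 0 ∧ a + c ≠ 0 ∧ b + c ≠ 0 ∧ a + (b + c) ≠ 0 := by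
  refine ⟨hS.ne_zero (by simp), hS.ne_zero (by simp), hS.ne_zero (by simp), ?_, ?_, ?_, ?_⟩
  · exact sum_pair (f := id) hab ▸ hS {a, b} (by grind) (by simp)
  · exact sum_pair (f := id) hac ▸ hS {a, c} (by grind) (by simp)
  · exact sum_pair (f := id) hbc ▸ hS {b, c} (by grind) (by simp)
  · have := hS {a, b, c} subset_rfl (by simp)
    rwa [sum_insert (by simp [hab, hac]), sum_pair hbc] at this

lemma ZeroSumFree.card_three (hodd : Odd (Nat.card G)) (hS : ZeroSumFree S) (h3 : #S = 3) :
    7 ≤ #S.subsetSum := by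
  obtain ⟨c, P, hc, rfl, hP⟩ := card_eq_succ.1 h3
  have h4 := (hS.mono (subset_insert c P)).card_two hP
  obtain ⟨a, b, hab, rfl⟩ := card_eq_two.1 hP
  have hne := hS.add_ne_zero (by grind) (by grind) hab
  have hrep : diffRep ({a, b} : Finset G).subsetSum c ≤ 1 := by
    refine card_le_one.2 fun u hu v hv => ?_
    rw [mem_inter, ← neg_vadd_mem_iff, vadd_eq_add, mem_subsetSum_pair hab,
      mem_subsetSum_pair hab] at hu hv
    have ha := eq_zero_of_add_self_eq_zero hodd (x := a)
    have hb := eq_zero_of_add_self_eq_zero hodd (x := b)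
    have hc := eq_zero_of_add_self_eq_zero hodd (x := c)
    have hcancel (x y z : G) (h : x + y = x + z) : y = z := add_left_cancel h
    grind
  have := card_subsetSum_insert_add_diffRep hc
  omega

/-- The `8` subset sums of three elements can only coincide if one element is the sum of the other
two, that is, twice it is the sum of all three. -/
lemma ZeroSumFree.card_three_of_forall_add_self_ne_sum (hS : ZeroSumFree S) (h3 : #S = 3)
    (h : ∀ p ∈ S, p + p ≠ ∑ x ∈ S, x) : 8 ≤ #S.subsetSum := by
  obtain ⟨c, P, hc, rfl, hP⟩ := card_eq_succ.1 h3
  have h4 := (hS.mono (subset_insert c P)).card_two hP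
  obtain ⟨a, b, hab, rfl⟩ := card_eq_two.1 hP
  have hne := hS.add_ne_zero (by grind) (by grind) hab
  have hrep : diffRep ({a, b} : Finset G).subsetSum c = 0 := by
    rw [← Nat.le_zero, ← not_lt, diffRep_pos, mem_sub]
    rintro ⟨u, hu, v, hv, huv⟩
    rw [mem_subsetSum_pair hab] at hu hv
    rw [sum_insert hc, sum_pair hab] at h
    have ha := h a (by simp)
    have hb := h b (by simp)
    have hc := h c (by simp)
    grind
  have := card_subsetSum_insert_add_diffRep hc
  omega

lemma ZeroSumFree.exists_eight_le_card_erase (hS : ZeroSumFree S) (h4 : #S = 4) :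
    ∃ q ∈ S, 8 ≤ #(S.erase q).subsetSum := by
  by_contra! hlt
  have hdouble : ∀ q ∈ S, ∃ p ∈ S, p + p = (∑ x ∈ S, x) - q := fun q hq => by
    by_contra! hne
    refine (hlt q hq).not_ge ((hS.mono (erase_subset q S)).card_three_of_forall_add_self_ne_sum
      (by rw [card_erase_of_mem hq, h4]) fun p hp => ?_)
    rw [sum_erase_eq_sub hq]
    exact hne p (mem_of_mem_erase hp)
  choose! f hfS hf using hdouble
  have hinj : Set.InjOn f S := fun q hq q' hq' h => by
    simpa using (hf q hq).symm.trans ((congrArg (fun p => p + p) h).trans (hf q' hq'))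
  have himage : S.image f = S :=
    eq_of_subset_of_card_le (image_subset_iff.2 hfS) (card_image_of_injOn hinj).ge
  -- Summing the relations `f q + f q = ∑ S - q` over `q ∈ S` gives `2 ∑ S = 4 ∑ S - ∑ S`.
  have hsum : (∑ x ∈ S, x) + ∑ x ∈ S, x = 4 • (∑ x ∈ S, x) - ∑ x ∈ S, x := by
    calc (∑ x ∈ S, x) + ∑ x ∈ S, x = ∑ q ∈ S, (f q + f q) := by
          rw [sum_add_distrib, ← sum_image (f := fun x => x) hinj, himage]
      _ = ∑ q ∈ S, ((∑ x ∈ S, x) - q) := sum_congr rfl hf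
      _ = 4 • (∑ x ∈ S, x) - ∑ x ∈ S, x := by rw [sum_sub_distrib, sum_const, h4]
  refine hS S subset_rfl (card_pos.1 (by omega)) ?_
  have : 4 • (∑ x ∈ S, x) - ∑ x ∈ S, x = (∑ x ∈ S, x) + (∑ x ∈ S, x) + ∑ x ∈ S, x := by abel
  rw [this] at hsum
  simpa using hsum

end FewElements

section Popular

variable {G : Type*} [AddCommGroup G] [DecidableEq G] {B C S : Finset G} {s t : ℕ}

lemma card_le_card_popular (h : ∀ x ∈ C, t < diffRep B x) : #C ≤ #(popular B t) :=
  card_le_card fun x hx => mem_popular.2 (h x hx)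

lemma card_popular_pos (ht : t < #B) : 1 ≤ #(popular B t) :=
  card_le_card_popular (C := {0}) (by simpa [diffRep_zero] using ht)

lemma card_add_le_card_popular (h : ∀ x ∈ C, s ≤ diffRep B x) (ht : t + #B < 2 * s) :
    #(C + C) ≤ #(popular B t) := by
  refine card_le_card_popular fun x hx => ?_
  obtain ⟨y, hy, z, hz, rfl⟩ := mem_add.1 hx
  have := diffRep_add_le B y z
  have := h y hy
  have := h z hz
  omega

lemma card_add_add_le_card_popular (h : ∀ x ∈ C, s ≤ diffRep B x) (ht : t + 2 * #B < 3 * s) :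
    #(C + C + C) ≤ #(popular B t) := by
  refine card_le_card_popular fun x hx => ?_
  obtain ⟨u, hu, w, hw, rfl⟩ := mem_add.1 hx
  obtain ⟨y, hy, z, hz, rfl⟩ := mem_add.1 hu
  have := diffRep_add_le B y z
  have := diffRep_add_le B (y + z) w
  have := h y hy
  have := h z hz
  have := h w hw
  omega

/-- If the differences in `C` have at least `s` representations, those in `C + C` and `C + C + C`
have at least `2 * s - #B` and `3 * s - 2 * #B`, and there are only `#B ^ 2` in total. -/
lemma sum_card_popular_lower_bound_le (h : ∀ x ∈ C, s ≤ diffRep B x) {c₁ c₂ c₃ : ℕ} (h₁ : c₁ ≤ #C)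
    (h₂ : c₂ ≤ #(C + C)) (h₃ : c₃ ≤ #(C + C + C)) :
    ∑ t ∈ range #B, (if t + 2 * #B < 3 * s then c₃ else if t + #B < 2 * s then c₂ else
      if t < s then c₁ else 1) ≤ #B ^ 2 := by
  rw [← sum_card_popular]
  refine sum_le_sum fun t ht => ?_
  split_ifs with ht₃ ht₂ ht₁
  · exact h₃.trans (card_add_add_le_card_popular h ht₃)
  · exact h₂.trans (card_add_le_card_popular h ht₂)
  · exact h₁.trans (card_le_card_popular fun x hx => ht₁.trans_le (h x hx))
  · exact card_popular_pos (mem_range.1 ht)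

lemma le_diffRep_of_mem_symHull (hs : s ≤ #B) (h : ∀ x ∈ S, s ≤ diffRep B x) :
    ∀ x ∈ symHull S, s ≤ diffRep B x := by
  intro x hx
  obtain rfl | hx | hx := mem_symHull.1 hx
  · rwa [diffRep_zero]
  · exact h x hx
  · exact (h _ hx).trans (diffRep_neg B x).le

lemma card_subsetSum_erase_le_diffRep {x : G} (hx : x ∈ S) :
    #(S.erase x).subsetSum ≤ diffRep S.subsetSum x := by
  simpa only [insert_erase hx] using card_subsetSum_le_diffRep_insert (notMem_erase x S)

lemma le_diffRep_of_le_card_erase (hne : S.Nonempty) (h : ∀ x ∈ S, s ≤ #(S.erase x).subsetSum) :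
    ∀ x ∈ symHull S, s ≤ diffRep S.subsetSum x := by
  obtain ⟨y, hy⟩ := hne
  exact le_diffRep_of_mem_symHull
    ((h y hy).trans (card_le_card (subsetSum_mono (erase_subset y S))))
    fun x hx => (h x hx).trans (card_subsetSum_erase_le_diffRep hx)

lemma ZeroSumFree.seven_le_diffRep (hodd : Odd (Nat.card G)) (hS : ZeroSumFree S) (h4 : #S = 4) :
    ∀ x ∈ symHull S, 7 ≤ diffRep S.subsetSum x :=
  le_diffRep_of_le_card_erase (card_pos.1 (by omega)) fun x hx =>
    (hS.mono (erase_subset x S)).card_three hodd (by rw [card_erase_of_mem hx, h4])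

lemma ZeroSumFree.card_four_of_large (hodd : Odd (Nat.card G)) (hS : ZeroSumFree S) (h4 : #S = 4)
    (hN : 15 ≤ Nat.card (AddSubgroup.closure (S : Set G))) : 10 ≤ #S.subsetSum := by
  have hrep := hS.seven_le_diffRep hodd h4
  have hge : 7 ≤ #S.subsetSum := (hrep 0 (zero_mem_symHull S)).trans (diffRep_zero _).le
  have hcard := card_symHull hodd hS
  have hsum := sum_card_popular_lower_bound_le hrep (c₁ := 9) (by omega)
    (le_card_symHull_add_symHull hodd hS hN (by omega))
    (le_card_symHull_add_symHull_add_symHull hodd hS hN (by omega))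
  by_contra! hlt
  generalize #S.subsetSum = b at hsum hge hlt
  interval_cases b <;> revert hsum <;> decide

end Popular

section SignedSums

variable {G : Type*} [AddCommGroup G] [DecidableEq G] {C S : Finset G}

lemma add_mem_subsetSum_sub_subsetSum_insert {q w y : G} (hw : w ∈ S.subsetSum - S.subsetSum)
    (hq : q ∉ S) (hy : y = q ∨ y = -q) :
    w + y ∈ (insert q S).subsetSum - (insert q S).subsetSum := by
  obtain ⟨u, hu, v, hv, rfl⟩ := mem_sub.1 hw
  rw [subsetSum_insert hq]
  obtain rfl | rfl := hy
  · exact mem_sub.2 ⟨y + u, mem_union_right _ (vadd_mem_vadd_finset hu), v, mem_union_left _ hv,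
      by abel⟩
  · exact mem_sub.2 ⟨u, mem_union_left _ hu, q + v, mem_union_right _ (vadd_mem_vadd_finset hv),
      by abel⟩

lemma two_le_diffRep_subsetSum_insert {q w : G} (hw : w ∈ S.subsetSum - S.subsetSum)
    (hq : q ∉ S) (hq0 : q ≠ 0) : 2 ≤ diffRep (insert q S).subsetSum w := by
  obtain ⟨u, hu, v, hv, rfl⟩ := mem_sub.1 hw
  have hne : u ≠ q + u := by simpa using hq0
  rw [← card_pair hne, diffRep, subsetSum_insert hq]
  refine card_le_card (insert_subset ?_ (singleton_subset_iff.2 ?_)) <;>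
    rw [mem_inter, ← neg_vadd_mem_iff (a := u - v)]
  · exact ⟨mem_union_left _ hu, mem_union_left _ (by simpa using hv)⟩
  · refine ⟨mem_union_right _ (vadd_mem_vadd_finset hu), mem_union_right _ ?_⟩
    convert vadd_mem_vadd_finset (a := q) hv using 1
    simp only [vadd_eq_add]
    abel

lemma exists_mem_subsetSum_sub_subsetSum {x y z : G} (hx : x ∈ symHull S) (hy : y ∈ symHull S)
    (hz : z ∈ symHull S) (hxy : x ≠ y) (hxz : x ≠ z) (hyz : y ≠ z)
    (h : x + y + z ∉ symHull S + symHull S) :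
    ∃ T ⊆ S, #T = 3 ∧ x + y + z ∈ T.subsetSum - T.subsetSum := by
  have hsign (x : G) (hx : x ∈ symHull S) (h0 : x ≠ 0) : ∃ q ∈ S, x = q ∨ x = -q := by
    obtain h | h | h := mem_symHull.1 hx
    · exact absurd h h0
    · exact ⟨x, h, Or.inl rfl⟩
    · exact ⟨-x, h, Or.inr (neg_neg x).symm⟩
  have hmem (u : G) (hu : u ∈ symHull S) (h0 : x + y + z = u) : False :=
    h (h0 ▸ add_zero u ▸ add_mem_add hu (zero_mem_symHull S))
  obtain ⟨a, ha, hxa⟩ := hsign x hx fun h0 => h (by simpa [h0] using add_mem_add hy hz)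
  obtain ⟨b, hb, hyb⟩ := hsign y hy fun h0 => h (by simpa [h0] using add_mem_add hx hz)
  obtain ⟨c, hc, hzc⟩ := hsign z hz fun h0 => h (by simpa [h0] using add_mem_add hx hy)
  have hab : a ≠ b := by grind
  have hac : a ≠ c := by grind
  have hbc : b ≠ c := by grind
  refine ⟨{a, b, c}, by grind, card_eq_three.2 ⟨a, b, c, hab, hac, hbc, rfl⟩, ?_⟩
  have h0 : (0 : G) ∈ (∅ : Finset G).subsetSum - (∅ : Finset G).subsetSum := by simp [subsetSum]
  have hc := add_mem_subsetSum_sub_subsetSum_insert h0 (notMem_empty c) hzc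
  have hbc := add_mem_subsetSum_sub_subsetSum_insert hc (by simpa using hbc) hyb
  have habc := add_mem_subsetSum_sub_subsetSum_insert hbc (by simp [hab, hac]) hxa
  rwa [insert_empty_eq, show 0 + z + y + x = x + y + z by abel] at habc

/-- Equal summands are made distinct by shifting them by `h` and `-h`. -/
lemma exists_distinct_add_notMem {h : G} (hC : h ∈ stabilizer G C) (hh : h + h ≠ 0)
    (hCCC : ¬ C + C + C ⊆ C + C) :
    ∃ x ∈ C, ∃ y ∈ C, ∃ z ∈ C, x ≠ y ∧ x ≠ z ∧ y ≠ z ∧ x + y + z ∉ C + C := by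
  have hshift (k : G) (hk : k ∈ stabilizer G C) (c : G) (hc : c ∈ C) : k + c ∈ C := by
    rw [← mem_stabilizer_iff.1 hk]
    exact vadd_mem_vadd_finset hc
  have hadd := hshift h hC
  have hsub := hshift (-h) (neg_mem hC)
  have hdouble (x : G) (hx : x ∈ C) (z : G) (hz : z ∈ C) (hw : x + x + z ∉ C + C) :
      ∃ x ∈ C, ∃ y ∈ C, ∃ z ∈ C, x ≠ y ∧ x ≠ z ∧ y ≠ z ∧ x + y + z ∉ C + C := by
    by_cases hzx : z = h + x ∨ z = -h + x
    · refine ⟨x, hx, h + x, hadd x hx, -h + x, hsub x hx, by grind, by grind, by grind,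
        fun hmem => ?_⟩
      obtain ⟨c, hc, d, hd, hcd⟩ := mem_add.1 hmem
      obtain rfl | rfl := hzx
      · exact hw (mem_add.2 ⟨h + c, hadd c hc, d, hd, by grind⟩)
      · exact hw (mem_add.2 ⟨-h + c, hsub c hc, d, hd, by grind⟩)
    · refine ⟨h + x, hadd x hx, -h + x, hsub x hx, z, hz, by grind, by grind, by grind, ?_⟩
      rwa [show h + x + (-h + x) + z = x + x + z by abel]
  obtain ⟨w, hw, hwC⟩ := not_subset.1 hCCC
  obtain ⟨u, hu, z, hz, rfl⟩ := mem_add.1 hw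
  obtain ⟨x, hx, y, hy, rfl⟩ := mem_add.1 hu
  by_cases hxy : x = y
  · exact hdouble x hx z hz (by grind)
  by_cases hxz : x = z
  · exact hdouble x hx y hy (by grind)
  by_cases hyz : y = z
  · exact hdouble y hy x hx (by grind)
  exact ⟨x, hx, y, hy, z, hz, hxy, hxz, hyz, hwC⟩

lemma exists_mem_stabilizer_of_card_add_le (hodd : Odd (Nat.card G)) (h0 : 0 ∈ C) (hneg : -C = C)
    (hC : #C = 9) (h15 : #(C + C) ≤ 15) (hCCC : ¬ C + C + C ⊆ C + C) :
    ∃ h ∈ stabilizer G C, h + h ≠ 0 := by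
  have hX : (C + C).Nonempty := ⟨_, add_mem_add h0 h0⟩
  have hkneser := kneser ⟨0, h0⟩ ⟨0, h0⟩
  have h0H : 0 ∈ addStab (C + C) := (mem_addStab hX).2 (zero_mem _)
  obtain ⟨k, hk⟩ := odd_card_addStab hodd hX
  have hCH : #C ≤ #(C + addStab (C + C)) := card_le_card (subset_add_left C h0H)
  obtain hsub | ⟨m, -, hm3, hm⟩ := subset_addStab_or_card_add_eq_mul hodd h0 hneg hX
  · refine absurd ?_ hCCC
    exact (add_subset_add_left hsub).trans (add_addStab _).subset
  have hkm : k = 1 := by nlinarith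
  have hCeq : C + addStab (C + C) = C :=
    (eq_of_subset_of_card_le (subset_add_left C h0H) (by rw [hm]; nlinarith)).symm
  obtain ⟨h, hh, hne⟩ := exists_mem_ne (s := addStab (C + C)) (by omega) 0
  refine ⟨h, ?_, fun h2 => hne (eq_zero_of_add_self_eq_zero hodd h2)⟩
  refine mem_stabilizer_iff.2 (eq_of_subset_of_card_le ?_ (card_vadd_finset h C).ge)
  rintro _ hy
  obtain ⟨c, hc, rfl⟩ := mem_vadd_finset.1 hy
  rw [vadd_eq_add, add_comm, ← hCeq]
  exact add_mem_add hc hh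

lemma ZeroSumFree.exists_mem_subsetSum_sub_notMem (hodd : Odd (Nat.card G)) (hS : ZeroSumFree S)
    (h4 : #S = 4) (hN : 21 ≤ Nat.card (AddSubgroup.closure (S : Set G)))
    (h15 : #(symHull S + symHull S) ≤ 15) :
    ∃ T ⊆ S, #T = 3 ∧ ∃ w ∈ T.subsetSum - T.subsetSum, w ∉ symHull S + symHull S := by
  have hcard := card_symHull hodd hS
  have hCCC : ¬ symHull S + symHull S + symHull S ⊆ symHull S + symHull S := fun hsub => by
    have := le_card_symHull_add_symHull_add_symHull hodd hS hN (by omega)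
    have := card_le_card hsub
    omega
  obtain ⟨h, hh, hne⟩ := exists_mem_stabilizer_of_card_add_le hodd (zero_mem_symHull S)
    (neg_symHull S) (by omega) h15 hCCC
  obtain ⟨x, hx, y, hy, z, hz, hxy, hxz, hyz, hw⟩ := exists_distinct_add_notMem hh hne hCCC
  obtain ⟨T, hT, hT3, hmem⟩ := exists_mem_subsetSum_sub_subsetSum hx hy hz hxy hxz hyz hw
  exact ⟨T, hT, hT3, _, hmem, hw⟩

end SignedSums

lemma closure_insert_of_mem {G : Type*} [AddGroup G] {s : Set G} {x : G}
    (hx : x ∈ AddSubgroup.closure s) :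
    AddSubgroup.closure (insert x s) = AddSubgroup.closure s :=
  le_antisymm ((AddSubgroup.closure_le _).2 (Set.insert_subset hx AddSubgroup.subset_closure))
    (AddSubgroup.closure_mono (Set.subset_insert x s))

section FiveAndSix

variable {G : Type*} [AddCommGroup G] [DecidableEq G] {S : Finset G} {x : G}

lemma ZeroSumFree.sixteen_le_card_popular (hodd : Odd (Nat.card G)) (hS : ZeroSumFree S)
    (h4 : #S = 4) (hN : 21 ≤ Nat.card (AddSubgroup.closure (S : Set G)))
    (h12 : #S.subsetSum ≤ 12) : 16 ≤ #(popular S.subsetSum 1) := by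
  have h : ∀ y ∈ symHull S + symHull S, 2 ≤ diffRep S.subsetSum y := fun y hy => by
    obtain ⟨u, hu, v, hv, rfl⟩ := mem_add.1 hy
    have := diffRep_add_le S.subsetSum u v
    have := hS.seven_le_diffRep hodd h4 u hu
    have := hS.seven_le_diffRep hodd h4 v hv
    omega
  obtain hlt | hge := lt_or_ge 15 #(symHull S + symHull S)
  · exact hlt.trans_le (card_le_card_popular h)
  obtain ⟨T, hTS, hT3, w, hw, hwC⟩ := hS.exists_mem_subsetSum_sub_notMem hodd h4 hN hge
  obtain ⟨d, hdS, hdT⟩ := exists_mem_notMem_of_card_lt_card (s := T) (t := S) (by omega)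
  have hins : insert d T = S := eq_of_subset_of_card_le (insert_subset hdS hTS)
    (by rw [card_insert_of_notMem hdT, hT3, h4])
  have hw2 := two_le_diffRep_subsetSum_insert hw hdT (hS.ne_zero hdS)
  rw [hins] at hw2
  have h15 := le_card_symHull_add_symHull hodd hS (n := 15) (by omega) (by omega)
  have hcard := card_le_card_popular (t := 1) ((forall_mem_insert _ _ _).2 ⟨hw2, h⟩)
  rw [card_insert_of_notMem hwC] at hcard
  omega

/-- The popular differences number at least `21, 16, 15, 15, 11, 9, 9, 3, 1, 1`, which exceeds the
total `10 ^ 2` by one, when `x` has as many as five representations. -/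
lemma ZeroSumFree.card_insert_of_card_eq_ten (hodd : Odd (Nat.card G)) (hx : x ∉ S)
    (hxS : ZeroSumFree (insert x S)) (h4 : #S = 4)
    (hN : 21 ≤ Nat.card (AddSubgroup.closure (S : Set G))) (h10 : #S.subsetSum = 10) :
    16 ≤ #(insert x S).subsetSum := by
  by_contra! hlt
  have hS := hxS.mono (subset_insert x S)
  have hx5 : 5 ≤ diffRep S.subsetSum x := by
    have := card_subsetSum_insert_add_diffRep hx
    omega
  have h7 := hS.seven_le_diffRep hodd h4
  have h5 := le_diffRep_of_mem_symHull (B := S.subsetSum) (s := 5) (by omega)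
    ((forall_mem_insert _ _ _).2
      ⟨hx5, fun y hy => le_trans (by decide) (h7 y (subset_symHull S hy))⟩)
  obtain ⟨q, hq, hq8⟩ := hS.exists_eight_le_card_erase h4
  have h8 := le_diffRep_of_mem_symHull (S := {q}) (B := S.subsetSum) (s := 8) (by omega)
    (by simpa using hq8.trans (card_subsetSum_erase_le_diffRep hq))
  have hhull := card_symHull hodd hS
  have hhullx := card_symHull hodd hxS
  rw [card_insert_of_notMem hx] at hhullx
  have hhullq := card_symHull hodd (hS.mono (singleton_subset_iff.2 hq))
  rw [card_singleton] at hhullq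
  have hdouble := le_card_symHull_add_symHull hodd hS (n := 15) (by omega) (by omega)
  have p₀ := (le_card_symHull_add_symHull_add_symHull hodd hS hN (by omega)).trans
    (card_add_add_le_card_popular h7 (t := 0) (by omega))
  have p₁ := hS.sixteen_le_card_popular hodd h4 hN (by omega)
  have p₂ := card_add_le_card_popular h7 (t := 2) (by omega)
  have p₃ := card_add_le_card_popular h7 (t := 3) (by omega)
  have p₄ := card_le_card_popular (t := 4) h5
  have p₅ := card_le_card_popular (t := 5) fun y hy => le_trans (by decide) (h7 y hy)
  have p₆ := card_le_card_popular (t := 6) h7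
  have p₇ := card_le_card_popular (t := 7) h8
  have p₈ := card_popular_pos (B := S.subsetSum) (t := 8) (by omega)
  have p₉ := card_popular_pos (B := S.subsetSum) (t := 9) (by omega)
  have hsum := sum_card_popular S.subsetSum
  simp only [h10, sum_range_succ, sum_range_zero] at hsum
  omega

lemma card_subsetSum_insert_of_notMem_closure (hx : x ∉ AddSubgroup.closure (S : Set G)) :
    #(insert x S).subsetSum = 2 * #S.subsetSum := by
  have hsub := subsetSum_subset_of_subset (AddSubgroup.subset_closure (k := (S : Set G)))
  rw [← card_subsetSum_insert_add_diffRep fun h => hx (AddSubgroup.subset_closure h),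
    left_eq_add, ← Nat.le_zero, ← not_lt, diffRep_pos]
  intro hmem
  obtain ⟨u, hu, v, hv, rfl⟩ := mem_sub.1 hmem
  exact hx (sub_mem (hsub hu) (hsub hv))

variable [IsAddCyclic G]

lemma ZeroSumFree.nine_le_card_four (hodd : Odd (Nat.card G)) (hS : ZeroSumFree S) (h4 : #S = 4) :
    10 ≤ #S.subsetSum ∨
      9 ≤ #S.subsetSum ∧ Nat.card (AddSubgroup.closure (S : Set G)) = 9 := by
  obtain h | h := le_or_gt 15 (Nat.card (AddSubgroup.closure (S : Set G)))
  · exact Or.inl (hS.card_four_of_large hodd h4 h)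
  · exact hS.card_four_of_small hodd h4 h

lemma ZeroSumFree.eleven_le_card_erase (hodd : Odd (Nat.card G)) (hS : ZeroSumFree S)
    (h5 : #S = 5) (hN : 21 ≤ Nat.card (AddSubgroup.closure (S : Set G)))
    (h15 : #S.subsetSum ≤ 15) : ∀ x ∈ S, 11 ≤ #(S.erase x).subsetSum := by
  intro x hx
  obtain ⟨Q, hxQ, rfl⟩ : ∃ Q, x ∉ Q ∧ insert x Q = S :=
    ⟨S.erase x, notMem_erase x S, insert_erase hx⟩
  rw [erase_insert hxQ]
  rw [card_insert_of_notMem hxQ] at h5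
  rw [coe_insert] at hN
  have h9 := (hS.mono (subset_insert x Q)).nine_le_card_four hodd (by omega)
  by_cases hcl : x ∈ AddSubgroup.closure (Q : Set G)
  · rw [closure_insert_of_mem hcl] at hN
    have := hS.card_insert_of_card_eq_ten hodd hxQ (by omega) hN
    omega
  · have := card_subsetSum_insert_of_notMem_closure hcl
    omega

lemma ZeroSumFree.card_five (hodd : Odd (Nat.card G)) (hS : ZeroSumFree S) (h5 : #S = 5) :
    15 ≤ #S.subsetSum := by
  obtain hN | hN := lt_or_ge (Nat.card (AddSubgroup.closure (S : Set G))) 21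
  · exact hS.card_five_of_small hodd h5 hN
  by_contra! hlt
  have hrep := le_diffRep_of_le_card_erase (card_pos.1 (by omega))
    (hS.eleven_le_card_erase hodd h5 hN hlt.le)
  have hge : 11 ≤ #S.subsetSum := (hrep 0 (zero_mem_symHull S)).trans (diffRep_zero _).le
  have hcard := card_symHull hodd hS
  have hdouble := le_card_symHull_add_symHull hodd hS hN (by omega)
  have hsum := sum_card_popular_lower_bound_le hrep (c₁ := 11) (by omega) hdouble
    (hdouble.trans (card_le_card (subset_add_left _ (zero_mem_symHull S))))
  generalize #S.subsetSum = b at hsum hge hlt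
  interval_cases b <;> revert hsum <;> decide

lemma ZeroSumFree.card_insert_of_card_eq_fifteen (hodd : Odd (Nat.card G)) (hx : x ∉ S)
    (hxS : ZeroSumFree (insert x S)) (h5 : #S = 5)
    (hN : 31 ≤ Nat.card (AddSubgroup.closure (S : Set G))) (h15 : #S.subsetSum = 15) :
    21 ≤ #(insert x S).subsetSum := by
  by_contra! hlt
  have hS := hxS.mono (subset_insert x S)
  have hx10 : 10 ≤ diffRep S.subsetSum x := by
    have := card_subsetSum_insert_add_diffRep hx
    omega
  have h11 := le_diffRep_of_le_card_erase (card_pos.1 (by omega))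
    (hS.eleven_le_card_erase hodd h5 (by omega) h15.le)
  have h10 := le_diffRep_of_mem_symHull (B := S.subsetSum) (s := 10) (by omega)
    ((forall_mem_insert _ _ _).2
      ⟨hx10, fun y hy => le_trans (by decide) (h11 y (subset_symHull S hy))⟩)
  have hhull := card_symHull hodd hS
  have hhullx := card_symHull hodd hxS
  rw [card_insert_of_notMem hx] at hhullx
  have hdouble := le_card_symHull_add_symHull hodd hS (n := 21) (by omega) (by omega)
  have htriple := le_card_symHull_add_symHull_add_symHull hodd hS hN (by omega)
  have hsum : ∑ t ∈ range 15, (if t < 3 then 31 else if t < 7 then 21 else if t < 10 then 13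
      else if t < 11 then 11 else 1) ≤ 15 ^ 2 := by
    rw [← h15, ← sum_card_popular]
    refine sum_le_sum fun t ht => ?_
    split_ifs with ht₃ ht₇ ht₁₀ ht₁₁
    · exact htriple.trans (card_add_add_le_card_popular h11 (by omega))
    · exact hdouble.trans (card_add_le_card_popular h11 (by omega))
    · exact (by omega : 13 ≤ _).trans (card_le_card_popular fun y hy => ht₁₀.trans_le (h10 y hy))
    · exact (by omega : 11 ≤ _).trans (card_le_card_popular fun y hy => ht₁₁.trans_le (h11 y hy))
    · exact card_popular_pos (mem_range.1 ht)
  revert hsum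
  decide

lemma ZeroSumFree.sixteen_le_card_erase (hodd : Odd (Nat.card G)) (hS : ZeroSumFree S)
    (h6 : #S = 6) (hN : 31 ≤ Nat.card (AddSubgroup.closure (S : Set G)))
    (h20 : #S.subsetSum ≤ 20) : ∀ x ∈ S, 16 ≤ #(S.erase x).subsetSum := by
  intro x hx
  obtain ⟨Q, hxQ, rfl⟩ : ∃ Q, x ∉ Q ∧ insert x Q = S :=
    ⟨S.erase x, notMem_erase x S, insert_erase hx⟩
  rw [erase_insert hxQ]
  rw [card_insert_of_notMem hxQ] at h6
  rw [coe_insert] at hN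
  have h15 := (hS.mono (subset_insert x Q)).card_five hodd (by omega)
  by_cases hcl : x ∈ AddSubgroup.closure (Q : Set G)
  · rw [closure_insert_of_mem hcl] at hN
    have := hS.card_insert_of_card_eq_fifteen hodd hxQ (by omega) hN
    omega
  · have := card_subsetSum_insert_of_notMem_closure hcl
    omega

lemma ZeroSumFree.card_six (hodd : Odd (Nat.card G)) (hS : ZeroSumFree S) (h6 : #S = 6) :
    21 ≤ #S.subsetSum := by
  obtain hN | hN := lt_or_ge (Nat.card (AddSubgroup.closure (S : Set G))) 31
  · exact hS.card_six_of_small hodd h6 hN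
  by_contra! hlt
  have hrep := le_diffRep_of_le_card_erase (card_pos.1 (by omega))
    (hS.sixteen_le_card_erase hodd h6 hN (by omega))
  have hge : 16 ≤ #S.subsetSum := (hrep 0 (zero_mem_symHull S)).trans (diffRep_zero _).le
  have hcard := card_symHull hodd hS
  have hsum := sum_card_popular_lower_bound_le hrep (c₁ := 13) (by omega)
    (le_card_symHull_add_symHull hodd hS (n := 25) (by omega) (by omega))
    (le_card_symHull_add_symHull_add_symHull hodd hS hN (by omega))
  generalize #S.subsetSum = b at hsum hge hlt
  interval_cases b <;> revert hsum <;> decide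

end FiveAndSix

section Multiplicities

variable {α : Type*} [DecidableEq α] {S : Multiset α} {U : Finset α} {h k : ℕ}

lemma val_le_of_subset_toFinset (hU : U ⊆ S.toFinset) : U.val ≤ S :=
  (val_le_iff.2 hU).trans (Multiset.dedup_le S)

lemma card_le_card_toFinset_mul (hcount : ∀ g, S.count g ≤ h) : S.card ≤ #S.toFinset * h := by
  rw [← Multiset.toFinset_sum_count_eq, ← smul_eq_mul]
  exact sum_le_card_nsmul _ _ _ fun g _ => hcount g

lemma card_filter_count_eq_mul_le (S : Multiset α) (m : ℕ) :
    #{g ∈ S.toFinset | S.count g = m} * m ≤ S.card := by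
  rw [← Multiset.toFinset_sum_count_eq, ← smul_eq_mul]
  exact (card_nsmul_le_sum _ _ _ fun g hg => (mem_filter.1 hg).2.ge).trans
    (sum_le_sum_of_subset (filter_subset _ _))

lemma exists_count_sub_le_card_sub_le (hcount : ∀ g, S.count g ≤ h + 1)
    (hcard : S.card ≤ k * (h + 1)) :
    ∃ U : Finset α, U.val ≤ S ∧ #U ≤ k ∧ (∀ g, (S - U.val).count g ≤ h) ∧
      (S - U.val).card ≤ k * h := by
  have hcount_sub (U : Finset α) (hU : {g ∈ S.toFinset | S.count g = h + 1} ⊆ U) (g : α) :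
      (S - U.val).count g ≤ h := by
    rw [Multiset.count_sub]
    have := hcount g
    by_cases hg : S.count g = h + 1
    · have hgU : g ∈ U := hU <| mem_filter.2
        ⟨Multiset.mem_toFinset.2 (Multiset.count_pos.1 (by omega)), hg⟩
      have := Multiset.one_le_count_iff_mem.2 (mem_val ▸ hgU)
      omega
    · omega
  obtain hlt | hle := lt_or_ge #S.toFinset k
  · refine ⟨S.toFinset, Multiset.dedup_le S, hlt.le, hcount_sub _ (filter_subset _ _), ?_⟩
    calc (S - S.toFinset.val).card ≤ #(S - S.toFinset.val).toFinset * h :=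
          card_le_card_toFinset_mul (hcount_sub _ (filter_subset _ _))
      _ ≤ k * h := by
          gcongr
          exact (card_le_card (Multiset.toFinset_subset.2
            (Multiset.subset_of_le (Multiset.sub_le_self _ _)))).trans hlt.le
  · obtain ⟨U, hmaxU, hUS, hUk⟩ := exists_subsuperset_card_eq (filter_subset _ S.toFinset)
      (Nat.le_of_mul_le_mul_right ((card_filter_count_eq_mul_le S (h + 1)).trans hcard)
        h.succ_pos) hle
    have hU := val_le_of_subset_toFinset hUS
    refine ⟨U, hU, hUk.le, hcount_sub U hmaxU, ?_⟩
    rw [Multiset.card_sub hU, card_val, hUk]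
    exact Nat.sub_le_of_le_add (by rwa [← mul_add_one])

end Multiplicities

section Sequences

variable {G : Type*} [AddCommGroup G] {S T : Multiset G} {U : Finset G} {h k r : ℕ}

lemma SeqZeroSumFree.eq_zero (hS : SeqZeroSumFree S) (hT : T ≤ S) (h : T.sum = 0) : T = 0 := by
  by_contra hne
  exact hS ⟨T, hT, Multiset.card_pos.2 hne, h⟩

lemma SeqZeroSumFree.mono (hS : SeqZeroSumFree S) (h : T ≤ S) : SeqZeroSumFree T :=
  fun ⟨U, hU, hpos, hsum⟩ => hS ⟨U, hU.trans h, hpos, hsum⟩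

lemma SeqZeroSumFree.zeroSumFree (hS : SeqZeroSumFree S) (hU : U.val ≤ S) : ZeroSumFree U :=
  fun V hV hne hsum => hne.ne_empty <| val_eq_zero.1 <|
    hS.eq_zero ((val_le_iff.2 hV).trans hU) ((sum_val V).trans hsum)

variable [DecidableEq G]

/-- The sums of all subsequences of `S`; unlike `seqSubsums`, the empty one is included. -/
def subseqSums (S : Multiset G) : Finset G := (S.powerset.map Multiset.sum).toFinset

lemma mem_subseqSums {g : G} : g ∈ subseqSums S ↔ ∃ T ≤ S, T.sum = g := by simp [subseqSums]

lemma zero_mem_subseqSums (S : Multiset G) : 0 ∈ subseqSums S :=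
  mem_subseqSums.2 ⟨0, Multiset.zero_le S, Multiset.sum_zero⟩

lemma subseqSums_add (S T : Multiset G) : subseqSums (S + T) = subseqSums S + subseqSums T := by
  ext g
  simp only [mem_add, mem_subseqSums]
  constructor
  · rintro ⟨U, hU, rfl⟩
    refine ⟨_, ⟨U ∩ S, Multiset.inter_le_right, rfl⟩, _, ⟨U - S, tsub_le_iff_left.2 hU, rfl⟩, ?_⟩
    rw [← Multiset.sum_add, add_comm, Multiset.sub_add_inter]
  · rintro ⟨_, ⟨U, hU, rfl⟩, _, ⟨V, hV, rfl⟩, rfl⟩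
    exact ⟨U + V, add_le_add hU hV, Multiset.sum_add U V⟩

lemma subseqSums_val (U : Finset G) : subseqSums U.val = U.subsetSum := by
  ext g
  rw [mem_subseqSums, mem_subsetSum_iff]
  constructor
  · rintro ⟨T, hT, rfl⟩
    exact ⟨⟨T, Multiset.nodup_of_le hT U.nodup⟩, val_le_iff.1 hT, (sum_val _).symm⟩
  · rintro ⟨V, hV, rfl⟩
    exact ⟨V.val, val_le_iff.2 hV, sum_val V⟩

lemma SeqZeroSumFree.card_subseqSums_add (h : SeqZeroSumFree (S + T)) :
    #(subseqSums S) + #(subseqSums T) ≤ #(subseqSums (S + T)) + 1 := by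
  rw [subseqSums_add]
  refine card_add_card_le_of_unique_zero (zero_mem_subseqSums S) (zero_mem_subseqSums T) ?_
  intro a ha b hb hab
  obtain ⟨U, hU, rfl⟩ := mem_subseqSums.1 ha
  obtain ⟨V, hV, rfl⟩ := mem_subseqSums.1 hb
  have hUV := h.eq_zero (add_le_add hU hV) (by rw [Multiset.sum_add, hab])
  rw [(add_eq_zero.1 hUV).2, Multiset.sum_zero]

lemma SeqZeroSumFree.card_subseqSums_sub (hS : SeqZeroSumFree S) (hU : U.val ≤ S) :
    #(subseqSums (S - U.val)) + #U.subsetSum ≤ #(subseqSums S) + 1 := by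
  have hadd := Multiset.sub_add_cancel hU
  rw [← hadd] at hS
  simpa only [subseqSums_val, hadd] using hS.card_subseqSums_add

variable [IsAddCyclic G]

lemma ZeroSumFree.six_mul_card_le (hodd : Odd (Nat.card G)) (hU : ZeroSumFree U) (h6 : #U ≤ 6) :
    6 * #U + 1 ≤ #U.subsetSum + 16 := by
  obtain h | h | h | h | h : #U ≤ 2 ∨ #U = 3 ∨ #U = 4 ∨ #U = 5 ∨ #U = 6 := by omega
  · omega
  · linarith [hU.card_three hodd h]
  · have := hU.nine_le_card_four hodd h
    omega
  · linarith [hU.card_five hodd h]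
  · linarith [hU.card_six hodd h]

lemma SeqZeroSumFree.le_card_subseqSums (hodd : Odd (Nat.card G)) (hS : SeqZeroSumFree S)
    (hcount : ∀ g, S.count g ≤ h) (hcard : S.card ≤ 6 * h) :
    6 * S.card + 1 ≤ #(subseqSums S) + 16 * h := by
  induction h generalizing S with
  | zero =>
    have := card_pos.2 ⟨0, zero_mem_subseqSums S⟩
    omega
  | succ h ih =>
    obtain ⟨U, hU, hU6, hcountU, hcardU⟩ := exists_count_sub_le_card_sub_le hcount hcard
    have hrest := ih (hS.mono (Multiset.sub_le_self S U.val)) hcountU hcardU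
    have hsplit := hS.card_subseqSums_sub hU
    have hset := (hS.zeroSumFree hU).six_mul_card_le hodd hU6
    have hle := Multiset.card_le_card hU
    rw [Multiset.card_sub hU] at hrest
    rw [card_val] at hrest hle
    omega

/-- Otherwise all four-element subsets generate the subgroup of order `9`, which has no room for the
`15` subset sums of `U`. -/
lemma ZeroSumFree.exists_ten_le_card (hodd : Odd (Nat.card G)) (hU : ZeroSumFree U)
    (h5 : #U = 5) : ∃ T ⊆ U, #T = 4 ∧ 10 ≤ #T.subsetSum := by
  by_contra! hlt
  have htorsion : (U : Set G) ⊆ (nsmulAddMonoidHom 9 : G →+ G).ker := by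
    intro u hu
    obtain ⟨y, hy, hyu⟩ := exists_mem_ne (s := U) (by omega) u
    have h4 : #(U.erase y) = 4 := by rw [card_erase_of_mem hy, h5]
    have h9 := (hU.mono (erase_subset y U)).nine_le_card_four hodd h4
    have hdvd := AddSubgroup.addOrderOf_dvd_natCard _
      (AddSubgroup.subset_closure (k := (U.erase y : Set G)) (mem_erase.2 ⟨hyu.symm, hu⟩))
    rw [(h9.resolve_left (hlt _ (erase_subset y U) h4).not_ge).2] at hdvd
    exact addOrderOf_dvd_iff_nsmul_eq_zero.1 hdvd
  have hker : Nat.card (nsmulAddMonoidHom 9 : G →+ G).ker ∣ 9 := by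
    rw [← IsAddCyclic.exponent_eq_card]
    exact AddMonoid.exponent_dvd_of_forall_nsmul_eq_zero fun x => Subtype.ext x.2
  have : Finite G := Nat.finite_of_card_ne_zero hodd.pos.ne'
  have hle : #U.subsetSum ≤ Nat.card (nsmulAddMonoidHom 9 : G →+ G).ker := by
    rw [← Set.ncard_coe_finset]
    exact Nat.card_mono (Set.toFinite _) (subsetSum_subset_of_subset htorsion)
  have := hU.card_five hodd h5
  have := Nat.le_of_dvd (by decide) hker
  omega

lemma ZeroSumFree.exists_subset_three_mul_card_le (hodd : Odd (Nat.card G)) (hU : ZeroSumFree U)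
    (hr : r ≤ 4) (hrU : r < #U) : ∃ T ⊆ U, #T = r ∧ 3 * r ≤ #T.subsetSum + 2 := by
  obtain rfl | hr3 := hr.eq_or_lt
  · obtain ⟨V, hVU, hV5⟩ := exists_subset_card_eq (show 5 ≤ #U from hrU)
    obtain ⟨T, hTV, hT4, h10⟩ := (hU.mono hVU).exists_ten_le_card hodd hV5
    exact ⟨T, hTV.trans hVU, hT4, by omega⟩
  obtain ⟨T, hTU, hTr⟩ := exists_subset_card_eq hrU.le
  have hT := hU.mono hTU
  refine ⟨T, hTU, hTr, ?_⟩
  obtain h | h | h : r ≤ 1 ∨ r = 2 ∨ r = 3 := by omega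
  · have : 0 < #T.subsetSum := card_pos.2 ⟨0, by simp⟩
    omega
  · linarith [hT.card_two (hTr.trans h)]
  · linarith [hT.card_three hodd (hTr.trans h)]

lemma SeqZeroSumFree.twenty_mul_add_le_card_subseqSums (hodd : Odd (Nat.card G))
    (hS : SeqZeroSumFree S) (hcount : ∀ g, S.count g ≤ h) (hr : r ≤ 4)
    (hcard : S.card = 6 * h + r) : 20 * h + 3 * r ≤ #(subseqSums S) + 2 := by
  obtain rfl | hr0 := r.eq_zero_or_pos
  · linarith [hS.le_card_subseqSums hodd hcount hcard.le]
  have hlt : r < #S.toFinset := by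
    by_contra! hle
    have := (card_le_card_toFinset_mul hcount).trans (Nat.mul_le_mul_right h (hle.trans hr))
    omega
  obtain ⟨T, hTS, hTr, hT⟩ := (hS.zeroSumFree (Multiset.dedup_le S)).exists_subset_three_mul_card_le
    (U := S.toFinset) hodd hr hlt
  have hTle := val_le_of_subset_toFinset hTS
  have hrest := (hS.mono (Multiset.sub_le_self S T.val)).le_card_subseqSums hodd
    (fun g => (Multiset.count_le_of_le g (Multiset.sub_le_self S T.val)).trans (hcount g))
    (by rw [Multiset.card_sub hTle, card_val]; omega)
  have hsplit := hS.card_subseqSums_sub hTle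
  rw [Multiset.card_sub hTle, card_val] at hrest
  omega

end Sequences

theorem corollary4p3 {G : Type*} [AddCommGroup G] [Finite G] [IsAddCyclic G] [DecidableEq G]
    (hodd : Odd (Nat.card G)) (S : Multiset G) (hS : SeqZeroSumFree S)
    (hlen : (6 * (Nat.card G : ℝ) + 26) / 20 ≤ (S.card : ℝ)) :
    ∃ g : G, g ∈ S ∧
      (6 * (S.card : ℝ) - (Nat.card G : ℝ) + 1) / 16 ≤ (S.count g : ℝ) := by
  by_contra! hlt
  have hlen : 6 * Nat.card G + 26 ≤ 20 * S.card := by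
    rw [div_le_iff₀ (by norm_num)] at hlen
    exact_mod_cast hlen.trans_eq (mul_comm _ _)
  have hcount (g : G) : S.count g ≤ (6 * S.card - Nat.card G) / 16 := by
    by_cases hg : g ∈ S
    · have hlt := hlt g hg
      rw [lt_div_iff₀ (by norm_num), ← sub_pos] at hlt
      have : S.count g * 16 + Nat.card G < 6 * S.card + 1 := by
        exact_mod_cast (by linarith : (S.count g * 16 + Nat.card G : ℝ) < 6 * S.card + 1)
      omega
    · exact (Multiset.count_eq_zero_of_notMem hg).trans_le (Nat.zero_le _)
  have hle : #(subseqSums S) ≤ Nat.card G := by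
    simpa [Set.ncard_univ] using Set.ncard_le_ncard (Set.subset_univ (subseqSums S : Set G))
  obtain hshort | hlong := le_or_gt S.card (6 * ((6 * S.card - Nat.card G) / 16))
  · have := hS.le_card_subseqSums hodd hcount hshort
    omega
  · have := hS.twenty_mul_add_le_card_subseqSums hodd hcount
      (r := S.card - 6 * ((6 * S.card - Nat.card G) / 16)) (by omega) (by omega)
    omega
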